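/- Fix an infinite set of variables. Formulas of the modal $\mu$-calculus are given by $\phi ::= \top \mid \bot \mid p \mid \neg p \mid \phi\land\phi \mid \phi\lor\phi \mid \Diamond\phi \mid \Box\phi \mid \mu x.\phi \mid \nu x.\phi$, where $\eta x.\phi$ ($\eta\in\{\mu,\nu\}$) may be formed only if $\phi$ is *positive in* $x$, i.e. $\neg x$ does not occur in $\phi$. $\overline\mu=\nu$, $\overline\nu=\mu$; $FV(\phi)$ and $BV(\phi)$ are the sets of free and bound variables of $\phi$. The formula $\phi$ is *tidy* if $FV(\phi)\cap BV(\phi)=\varnothing$. A formula $\psi$ is *free for* $x$ in $\phi$ if $\phi$ is positive in $x$ and no free occurrence of $x$ in $\phi$ lies in the scope of an operator $\eta y$ with $y\in FV(\psi)$; $\phi[\psi/x]$ is the result of substituting $\psi$ for the free occurrences of $x$. *Closure.* Let $\to_C$ be the relation given by $\phi_0\odot\phi_1\to_C\phi_i$ ($\odot\in\{\land,\lor\}$, $i \in \{0,1\}$), $\heartsuit\phi\to_C\phi$ ($\heartsuit\in\{\Diamond,\Box\}$) and $\eta x.\phi\to_C\phi[\eta x.\phi/x]$. A trace is a finite $\to_C$-path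 (possibly of length zero), $\mathit{Clos}(\xi)$ is the set of formulas reachable from $\xi$ by a trace, and the *cluster* of $\phi$ is the set of all $\psi$ with $\psi\in\mathit{Clos}(\phi)$ and $\phi\in\mathit{Clos}(\psi)$. A formula $\phi$ is a *free subformula* of $\psi$ if $\psi=\psi'[\phi/x]$ for some formula $\psi'$ and variable $x\in FV(\psi')$ such that $\phi$ is free for $x$ in $\psi'$. For fixpoint formulas $\phi,\psi$ put $\phi\sqsubseteq_C\psi$ if there is a trace from $\psi$ to $\phi$ such that $\psi$ is a free subformula of every formula on it, and $\phi\sqsubset_C\psi$ if $\phi\sqsubseteq_C\psi$ and $\psi\not\sqsubseteq_C\phi$. An *alternating $\sqsubset_C$-chain* of length $n \geq 0$ is a sequence $(\eta_i x_i.\chi_i)_{1\le i\le n}$ of tidy fixpoint formulas with $\eta_i x_i.\chi_i\sqsubset_C\eta_{i+1}x_{i+1}.\chi_{i+1}$ and $\eta_{i+1}=\overline{\eta_i}$ for $1\le i<n$; for $n \geq 1$ it leads up to the $\eta_n$-formula $\eta_n x_n.\chi_n$. For a formula $\xi$, $\mathit{cd}_\eta(\xi)$ (respectively $\mathit{cd}(\xi)$)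 is the maximal length of an alternating $\sqsubset_C$-chain that is contained in the cluster of some element of $\mathit{Clos}(\xi)$ and leads up to an $\eta$-formula (respectively, without the latter condition); the maximum is $0$ if there is no such chain. *Alternation hierarchy.* The classes $AH_\mu(n),AH_\nu(n)$ ($n\in\mathbb N$) are the smallest classes of formulas such that, for all $\eta,\lambda\in\{\mu,\nu\}$ and $n$: (1) atomic formulas ($\top,\bot,p,\neg p$) are in $AH_\eta(0)$; (2) $AH_\eta(n)$ is closed under $\land,\lor,\Diamond,\Box$; (3) if $\phi\in AH_\eta(n)$ is positive in $x$, then $\overline\eta x.\phi\in AH_\eta(n)$; (4) if $\phi,\psi\in AH_\eta(n)$ and $\psi$ is free for $x$ in $\phi$, then $\phi[\psi/x]\in AH_\eta(n)$; (5) $AH_\lambda(n)\subseteq AH_\eta(n+1)$. The *alternation depth* $\mathit{ad}(\xi)$ is the least $n$ with $\xi\in AH_\mu(n)\cap AH_\nu(n)$. **Proposition.** Let $\xi$ be a tidy formula. For every $\eta\in\{\mu,\nu\}$ and every $n\in\mathbb N$, $$\mathit{cd}_\eta(\xi)\le n \iff \xi\in AH_\eta(n).$$ Consequently $\mathit{ad}(\xi)$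 exists and $\mathit{ad}(\xi)=\mathit{cd}(\xi)$, and this number is the length of a longest alternating $\sqsubset_C$-chain of formulas in $\mathit{Clos}(\xi)$. -/

import Mathlib

/-- The two fixpoint operators. -/
inductive FixOp : Type
  | mu
  | nu

/-- The dual operator. -/
def FixOp.dual : FixOp → FixOp
  | .mu => .nu
  | .nu => .mu

/-- Raw modal fixpoint formulas in negation normal form. The proviso on the formation of
`η x. φ` is imposed by `MuForm.WF` below. -/
inductive MuForm (V : Type*) : Type _
  | top : MuForm V
  | bot : MuForm V
  | var : V → MuForm V
  | negvar : V → MuForm V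
  | and : MuForm V → MuForm V → MuForm V
  | or : MuForm V → MuForm V → MuForm V
  | dia : MuForm V → MuForm V
  | box : MuForm V → MuForm V
  | fix : FixOp → V → MuForm V → MuForm V

namespace MuForm

variable {V : Type*}

/-- `φ` is positive in `x`: the literal `¬x` does not occur in `φ`. -/
def PosIn (x : V) : MuForm V → Prop
  | top => True
  | bot => True
  | var _ => True
  | negvar p => p ≠ x
  | and φ ψ => PosIn x φ ∧ PosIn x ψ
  | or φ ψ => PosIn x φ ∧ PosIn x ψ
  | dia φ => PosIn x φ
  | box φ => PosIn x φ
  | fix _ _ φ => PosIn x φ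

/-- The raw formula is a formula of the modal `μ`-calculus: every fixpoint operator `η x`
is applied to a formula that is positive in `x`. -/
def WF : MuForm V → Prop
  | top => True
  | bot => True
  | var _ => True
  | negvar _ => True
  | and φ ψ => WF φ ∧ WF ψ
  | or φ ψ => WF φ ∧ WF ψ
  | dia φ => WF φ
  | box φ => WF φ
  | fix _ x φ => PosIn x φ ∧ WF φ

/-- Atomic formulas. -/
def IsAtomic : MuForm V → Prop
  | top => True
  | bot => True
  | var _ => True
  | negvar _ => True
  | _ => False

/-- `φ` is of the form `η x. χ` for the given operator `η`. -/
def IsFixOf (η : FixOp) (φ : MuForm V) : Prop :=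
  ∃ (x : V) (χ : MuForm V), φ = fix η x χ

/-- `φ` is a fixpoint formula. -/
def IsFix (φ : MuForm V) : Prop := ∃ η, IsFixOf η φ

/-- Free variables. -/
def FV : MuForm V → Set V
  | top => ∅
  | bot => ∅
  | var p => {p}
  | negvar p => {p}
  | and φ ψ => FV φ ∪ FV ψ
  | or φ ψ => FV φ ∪ FV ψ
  | dia φ => FV φ
  | box φ => FV φ
  | fix _ x φ => FV φ \ {x}

/-- Bound variables. -/
def BV : MuForm V → Set V
  | top => ∅
  | bot => ∅
  | var _ => ∅
  | negvar _ => ∅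
  | and φ ψ => BV φ ∪ BV ψ
  | or φ ψ => BV φ ∪ BV ψ
  | dia φ => BV φ
  | box φ => BV φ
  | fix _ x φ => insert x (BV φ)

/-- A tidy formula: no variable occurs both free and bound. -/
structure IsTidy (φ : MuForm V) : Prop where
  wf : WF φ
  disj : Disjoint (FV φ) (BV φ)

/-- Replacing the free occurrences of `x` by `ψ` never captures a free variable of `ψ`. -/
def NoCapture (ψ : MuForm V) (x : V) : MuForm V → Prop
  | top => True
  | bot => True
  | var _ => True
  | negvar _ => True
  | and φ χ => NoCapture ψ x φ ∧ NoCapture ψ x χ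
  | or φ χ => NoCapture ψ x φ ∧ NoCapture ψ x χ
  | dia φ => NoCapture ψ x φ
  | box φ => NoCapture ψ x φ
  | fix _ y φ => y = x ∨ (NoCapture ψ x φ ∧ (x ∈ FV φ → y ∉ FV ψ))

/-- `ψ` is free for `x` in `φ`. -/
def FreeFor (ψ : MuForm V) (x : V) (φ : MuForm V) : Prop :=
  PosIn x φ ∧ NoCapture ψ x φ

/-- The substitution `φ[ψ/x]`. It has its usual meaning when `ψ` is free for `x` in `φ`. -/
def subst [DecidableEq V] (ψ : MuForm V) (x : V) : MuForm V → MuForm V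
  | top => top
  | bot => bot
  | var p => if p = x then ψ else var p
  | negvar p => negvar p
  | and φ χ => and (subst ψ x φ) (subst ψ x χ)
  | or φ χ => or (subst ψ x φ) (subst ψ x χ)
  | dia φ => dia (subst ψ x φ)
  | box φ => box (subst ψ x φ)
  | fix η y φ => if y = x then fix η y φ else fix η y (subst ψ x φ)

variable [DecidableEq V]

/-- `φ` is a free subformula of `ψ`: `ψ = ψ'[φ/x]` for some formula `ψ'` with `x ∈ FV ψ'`
and `φ` free for `x` in `ψ'`. -/
def FreeSub (φ ψ : MuForm V) : Prop :=
  ∃ (ψ' : MuForm V) (x : V), WF ψ' ∧ x ∈ FV ψ' ∧ FreeFor φ x ψ' ∧ ψ = subst φ x ψ'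

/-- The trace relation `φ →_C ψ`. A fixpoint formula has its unfolding as only successor. -/
inductive TraceStep : MuForm V → MuForm V → Prop
  | and_left (φ ψ : MuForm V) : TraceStep (and φ ψ) φ
  | and_right (φ ψ : MuForm V) : TraceStep (and φ ψ) ψ
  | or_left (φ ψ : MuForm V) : TraceStep (or φ ψ) φ
  | or_right (φ ψ : MuForm V) : TraceStep (or φ ψ) ψ
  | dia (φ : MuForm V) : TraceStep (dia φ) φ
  | box (φ : MuForm V) : TraceStep (box φ) φ
  | fix (η : FixOp) (x : V) (φ : MuForm V) :
      TraceStep (fix η x φ) (subst (fix η x φ) x φ)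

/-- There is a (possibly empty) trace from `φ` to `ψ`. -/
def Reach (φ ψ : MuForm V) : Prop := Relation.ReflTransGen TraceStep φ ψ

/-- The closure of `ξ`. -/
def Clos (ξ : MuForm V) : Set (MuForm V) := {φ | Reach ξ φ}

/-- The closure cluster of `φ`: the class of `φ` under mutual reachability. -/
def cluster (φ : MuForm V) : Set (MuForm V) := {ψ | Reach φ ψ ∧ Reach ψ φ}

/-- There is a trace from `ρ` to `σ` such that `ψ` is a free subformula of every formula
on it, both ends included. -/
def ReachThrough (ψ ρ σ : MuForm V) : Prop :=
  FreeSub ψ ρ ∧ Relation.ReflTransGen (fun α β => TraceStep α β ∧ FreeSub ψ β) ρ σ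

/-- The closure priority relation `φ ⊑_C ψ` between fixpoint formulas. -/
def ClosLE (φ ψ : MuForm V) : Prop :=
  IsFix φ ∧ IsFix ψ ∧ ReachThrough ψ ψ φ

/-- Its strict version `φ ⊏_C ψ`. -/
def ClosLT (φ ψ : MuForm V) : Prop := ClosLE φ ψ ∧ ¬ ClosLE ψ φ

/-- Alternating `⊏_C`-chains, as lists of tidy fixpoint formulas in increasing order.
The length of the chain is the length of the list; the empty chain has length `0`. -/
def IsAltChain (c : List (MuForm V)) : Prop :=
  (∀ φ ∈ c, IsTidy φ ∧ IsFix φ) ∧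
  c.IsChain (fun φ ψ => ClosLT φ ψ ∧ ∃ η, IsFixOf η φ ∧ IsFixOf η.dual ψ)

/-- The chain `c` leads up to (has as last element) an `η`-formula. -/
def LeadsUpTo (η : FixOp) (c : List (MuForm V)) : Prop :=
  ∃ φ ∈ c.getLast?, IsFixOf η φ

/-- Maximal length of an alternating chain in `C` leading up to an `η`-formula. -/
noncomputable def cdEtaCluster (η : FixOp) (C : Set (MuForm V)) : ℕ∞ :=
  ⨆ (c : List (MuForm V)) (_ : IsAltChain c ∧ (∀ φ ∈ c, φ ∈ C) ∧ LeadsUpTo η c),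
    (c.length : ℕ∞)

/-- Maximal length of an alternating chain in `C`. -/
noncomputable def cdCluster (C : Set (MuForm V)) : ℕ∞ :=
  ⨆ (c : List (MuForm V)) (_ : IsAltChain c ∧ ∀ φ ∈ c, φ ∈ C), (c.length : ℕ∞)

/-- `cd_η(ξ)`: the maximum of `cd_η(C)` over the clusters `C` of the closure of `ξ`. -/
noncomputable def cdEta (η : FixOp) (ξ : MuForm V) : ℕ∞ :=
  ⨆ φ ∈ Clos ξ, cdEtaCluster η (cluster φ)

/-- `cd(ξ)`: the maximum of `cd(C)` over the clusters `C` of the closure of `ξ`. -/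
noncomputable def cd (ξ : MuForm V) : ℕ∞ :=
  ⨆ φ ∈ Clos ξ, cdCluster (cluster φ)

/-- The alternation hierarchy: `AH η n φ` says that `φ` belongs to the class `AH_η(n)`. -/
inductive AH : FixOp → ℕ → MuForm V → Prop
  | atom (η : FixOp) {φ : MuForm V} : IsAtomic φ → AH η 0 φ
  | and {η : FixOp} {n : ℕ} {φ ψ : MuForm V} : AH η n φ → AH η n ψ → AH η n (and φ ψ)
  | or {η : FixOp} {n : ℕ} {φ ψ : MuForm V} : AH η n φ → AH η n ψ → AH η n (or φ ψ)
  | dia {η : FixOp} {n : ℕ} {φ : MuForm V} : AH η n φ → AH η n (dia φ)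
  | box {η : FixOp} {n : ℕ} {φ : MuForm V} : AH η n φ → AH η n (box φ)
  | fix {η : FixOp} {n : ℕ} {φ : MuForm V} (x : V) :
      PosIn x φ → AH η n φ → AH η n (fix η.dual x φ)
  | subst {η : FixOp} {n : ℕ} {φ ψ : MuForm V} (x : V) :
      FreeFor ψ x φ → AH η n φ → AH η n ψ → AH η n (subst ψ x φ)
  | lift {η' : FixOp} {n : ℕ} {φ : MuForm V} (η : FixOp) : AH η' n φ → AH η (n + 1) φ

/-- The alternation depth of `ξ`: the least `n` such that `ξ` lies in both `AH_μ(n)` and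
`AH_ν(n)`. -/
noncomputable def ad (ξ : MuForm V) : ℕ := sInf {n | AH .mu n ξ ∧ AH .nu n ξ}

end MuForm

namespace MuForm

variable {V : Type*}

theorem _root_.FixOp.dual_dual (η : FixOp) : η.dual.dual = η := by cases η <;> rfl

theorem _root_.FixOp.dual_ne (η : FixOp) : η.dual ≠ η := by cases η <;> simp [FixOp.dual]

theorem _root_.FixOp.eq_or_eq_dual (η η' : FixOp) : η' = η ∨ η' = η.dual := by
  cases η <;> cases η' <;> simp [FixOp.dual]

/-- The number of nodes of the syntax tree. -/
def size : MuForm V → ℕ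
  | top => 1
  | bot => 1
  | var _ => 1
  | negvar _ => 1
  | and φ ψ => size φ + size ψ + 1
  | or φ ψ => size φ + size ψ + 1
  | dia φ => size φ + 1
  | box φ => size φ + 1
  | fix _ _ φ => size φ + 1

/-! ### Variables -/

theorem finite_FV (φ : MuForm V) : (FV φ).Finite := by
  induction φ <;> simp_all [FV, Set.Finite.sdiff]

theorem finite_BV (φ : MuForm V) : (BV φ).Finite := by
  induction φ <;> simp_all [BV]

theorem exists_fresh [Infinite V] (φ : MuForm V) : ∃ z, z ∉ FV φ ∧ z ∉ BV φ := by
  obtain ⟨z, hz⟩ := ((finite_FV φ).union (finite_BV φ)).exists_notMem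
  exact ⟨z, fun h => hz (Or.inl h), fun h => hz (Or.inr h)⟩

theorem posIn_of_fresh {z : V} {φ : MuForm V} (h : z ∉ FV φ) (h' : z ∉ BV φ) : PosIn z φ := by
  induction φ with
  | fix η y a ih =>
    simp only [FV, BV, Set.mem_sdiff, Set.mem_singleton_iff, Set.mem_insert_iff, not_or] at h h'
    exact ih (fun hz => h ⟨hz, h'.1⟩) h'.2
  | _ => simp_all [FV, BV, PosIn, eq_comm]

theorem WF.posIn {y : V} {φ : MuForm V} (hw : WF φ) (h : y ∉ FV φ) : PosIn y φ := by
  induction φ with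
  | fix η w a ih =>
    simp only [FV, Set.mem_sdiff, Set.mem_singleton_iff, not_and, not_not] at h
    by_cases hy : y ∈ FV a
    · rw [h hy]; exact hw.1
    · exact ih hw.2 hy
  | _ => simp_all [FV, WF, PosIn, eq_comm]

theorem noCapture_of_disjoint {ψ : MuForm V} {x : V} {φ : MuForm V}
    (h : Disjoint (FV ψ) (BV φ)) : NoCapture ψ x φ := by
  induction φ with
  | fix η y a ih =>
    simp only [BV, Set.disjoint_insert_right] at h
    exact Or.inr ⟨ih h.2, fun _ => h.1⟩
  | _ => simp_all [BV, NoCapture]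

theorem IsTidy.freeFor {η : FixOp} {x : V} {a : MuForm V} (h : IsTidy (fix η x a)) :
    FreeFor (fix η x a) x a :=
  ⟨h.wf.1, noCapture_of_disjoint (h.disj.mono_right (Set.subset_insert _ _))⟩

/-! ### Substitution -/

variable [DecidableEq V]

theorem subst_of_notMem {ψ : MuForm V} {x : V} {φ : MuForm V} (h : x ∉ FV φ) :
    subst ψ x φ = φ := by
  induction φ with
  | fix η y a ih =>
    simp only [FV, Set.mem_sdiff, Set.mem_singleton_iff, not_and, not_not] at h
    by_cases hy : y = x
    · simp [subst, hy]
    · simp only [subst, hy, if_false]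
      rw [ih fun hx => hy (h hx).symm]
  | var p =>
    have hp : ¬ p = x := fun e => h e.symm
    simp [subst, hp]
  | _ => simp_all [FV, subst]

theorem mem_FV_subst {ψ : MuForm V} {x : V} {φ : MuForm V} (h : FreeFor ψ x φ) (v : V) :
    v ∈ FV (subst ψ x φ) ↔ (v ∈ FV φ ∧ v ≠ x) ∨ (x ∈ FV φ ∧ v ∈ FV ψ) := by
  obtain ⟨hp, hc⟩ := h
  induction φ with
  | var p =>
    by_cases hpx : p = x
    · subst hpx; simp [subst, FV]
    · have : x ≠ p := fun h => hpx h.symm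
      simp only [subst, hpx, if_false, FV, Set.mem_singleton_iff, this, false_and, or_false]
      constructor
      · rintro rfl; exact ⟨rfl, hpx⟩
      · exact fun h => h.1
  | negvar p =>
    simp only [PosIn] at hp
    simp only [subst, FV, Set.mem_singleton_iff]
    constructor
    · rintro rfl; exact Or.inl ⟨rfl, hp⟩
    · rintro (h | h)
      · exact h.1
      · exact absurd h.1.symm hp
  | fix η y a ih =>
    rcases hc with rfl | ⟨hc, hy⟩
    · simp only [subst, if_true, FV, Set.mem_sdiff, Set.mem_singleton_iff]; tauto
    · by_cases hyx : y = x
      · subst hyx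
        simp only [subst, if_true, FV, Set.mem_sdiff, Set.mem_singleton_iff]; tauto
      · have hxy : x ≠ y := fun h => hyx h.symm
        simp only [subst, hyx, if_false, FV, Set.mem_sdiff, Set.mem_singleton_iff, ih hp hc]
        constructor
        · tauto
        · rintro (h | h)
          · tauto
          · refine ⟨Or.inr ⟨h.1.1, h.2⟩, ?_⟩
            rintro rfl
            exact hy h.1.1 h.2
  | and a b iha ihb | or a b iha ihb =>
    simp only [subst, FV, Set.mem_union, iha hp.1 hc.1, ihb hp.2 hc.2]; grind
  | dia a ih | box a ih => simpa only [subst, FV] using ih hp hc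
  | top | bot => simp [subst, FV]

theorem BV_subst_subset (ψ : MuForm V) (x : V) (φ : MuForm V) :
    BV (subst ψ x φ) ⊆ BV φ ∪ BV ψ := by
  induction φ with
  | var p => by_cases h : p = x <;> simp [subst, h, BV]
  | fix η y a ih =>
    by_cases h : y = x
    · simp [subst, h, BV]
    · simp only [subst, h, if_false, BV]
      intro v hv
      rcases hv with rfl | hv
      · exact Or.inl (Or.inl rfl)
      · exact (ih hv).imp Or.inr id
  | and a b iha ihb | or a b iha ihb =>
    simp only [subst, BV]
    rintro v (hv | hv)
    · exact (iha hv).imp Or.inl id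
    · exact (ihb hv).imp Or.inr id
  | _ => simp_all [subst, BV]

theorem PosIn.subst {v : V} {ψ : MuForm V} {x : V} {φ : MuForm V} (h : PosIn v φ)
    (h' : PosIn v ψ) : PosIn v (subst ψ x φ) := by
  induction φ with
  | var p => by_cases hp : p = x <;> simp [MuForm.subst, hp, h', PosIn]
  | fix η y a ih =>
    by_cases hy : y = x
    · simpa [MuForm.subst, hy] using h
    · simpa [MuForm.subst, hy, PosIn] using ih h
  | _ => simp_all [MuForm.subst, PosIn]

theorem WF.subst {ψ : MuForm V} {x : V} {φ : MuForm V} (hφ : WF φ) (hψ : WF ψ)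
    (h : FreeFor ψ x φ) : WF (subst ψ x φ) := by
  obtain ⟨hp, hc⟩ := h
  induction φ with
  | var p => by_cases hp : p = x <;> simp [MuForm.subst, hp, hψ, WF]
  | fix η y a ih =>
    by_cases hy : y = x
    · simpa [MuForm.subst, hy] using hφ
    · simp only [MuForm.subst, hy, if_false]
      rcases hc with h | ⟨hc, hy'⟩
      · exact absurd h hy
      · by_cases hx : x ∈ FV a
        · exact ⟨hφ.1.subst (hψ.posIn (hy' hx)), ih hφ.2 hp hc⟩
        · rw [subst_of_notMem hx]; exact hφ
  | _ => simp_all [MuForm.subst, WF, PosIn, NoCapture]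

theorem eq_var_or_size_lt_subst {ψ : MuForm V} {x : V} {φ : MuForm V} (hp : PosIn x φ)
    (hx : x ∈ FV φ) : φ = var x ∨ size ψ < size (subst ψ x φ) := by
  have key : size ψ ≤ size (subst ψ x φ) ∧ (φ = var x ∨ size ψ < size (subst ψ x φ)) := by
    induction φ with
    | var p => simp only [FV, Set.mem_singleton_iff] at hx; simp [subst, hx]
    | negvar p => simp only [FV, Set.mem_singleton_iff] at hx; exact absurd hx.symm hp
    | fix η y a ih =>
      have hyx : ¬ y = x := fun h => hx.2 h.symm
      have := (ih hp hx.1).1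
      simp only [subst, hyx, if_false, size]
      omega
    | and a b iha ihb | or a b iha ihb =>
      simp only [subst, size]
      rcases hx with hx | hx
      · have := (iha hp.1 hx).1; omega
      · have := (ihb hp.2 hx).1; omega
    | dia a ih | box a ih =>
      have := (ih hp hx).1
      simp only [subst, size]
      omega
    | top | bot => simp [FV] at hx
  exact key.2

theorem subst_subst {χ ψ : MuForm V} {y z : V} {φ : MuForm V} (hyz : y ≠ z) (hy : y ∉ FV ψ)
    (hz : z ∉ BV φ) :
    subst ψ z (subst χ y φ) = subst (subst ψ z χ) y (subst ψ z φ) := by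
  induction φ with
  | var p =>
    by_cases hp : p = y
    · subst hp; simp [subst, hyz]
    · by_cases hpz : p = z
      · subst hpz; simp [subst, hp, subst_of_notMem hy]
      · simp [subst, hp, hpz]
  | fix η w a ih =>
    simp only [BV, Set.mem_insert_iff, not_or] at hz
    have hwz : ¬ w = z := fun h => hz.1 h.symm
    by_cases hw : w = y
    · subst hw; simp [subst, hwz]
    · simp [subst, hw, hwz, ih hz.2]
  | _ => simp_all [subst, BV]

/-- Renaming to a fresh variable `z` before substituting for `z`. -/
theorem subst_subst_var {ψ : MuForm V} {x z : V} {φ : MuForm V} (hz : z ∉ FV φ)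
    (hz' : z ∉ BV φ) : subst ψ z (subst (var z) x φ) = subst ψ x φ := by
  induction φ with
  | var p =>
    simp only [FV, Set.mem_singleton_iff] at hz
    have : ¬ p = z := fun h => hz h.symm
    by_cases hp : p = x <;> simp [subst, hp, this]
  | fix η w a ih =>
    simp only [BV, FV, Set.mem_insert_iff, not_or, Set.mem_sdiff, Set.mem_singleton_iff] at hz hz'
    have hwz : ¬ w = z := fun h => hz'.1 h.symm
    have hza : z ∉ FV a := fun h => hz ⟨h, hz'.1⟩
    by_cases hw : w = x
    · subst hw
      simp [subst, hwz, subst_of_notMem hza]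
    · simp [subst, hw, hwz, ih hza hz'.2]
  | _ => simp_all [subst, BV, FV]

/-! ### Tidy formulas and traces -/

theorem TraceStep.FV_subset {φ φ' : MuForm V} (h : TraceStep φ φ') (ht : IsTidy φ) :
    FV φ' ⊆ FV φ := by
  cases h with
  | fix η x a =>
    intro v hv
    rw [mem_FV_subst ht.freeFor] at hv
    rcases hv with hv | hv
    · exact hv
    · exact hv.2
  | and_left | or_left => exact Set.subset_union_left
  | and_right | or_right => exact Set.subset_union_right
  | dia | box => exact subset_rfl

theorem TraceStep.BV_subset {φ φ' : MuForm V} (h : TraceStep φ φ') : BV φ' ⊆ BV φ := by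
  cases h with
  | fix η x a =>
    exact (BV_subst_subset _ _ _).trans
      (Set.union_subset (Set.subset_insert _ _) subset_rfl)
  | and_left | or_left => exact Set.subset_union_left
  | and_right | or_right => exact Set.subset_union_right
  | dia | box => exact subset_rfl

theorem TraceStep.isTidy {φ φ' : MuForm V} (h : TraceStep φ φ') (ht : IsTidy φ) :
    IsTidy φ' := by
  refine ⟨?_, ht.disj.mono (h.FV_subset ht) h.BV_subset⟩
  have hw := ht.wf
  cases h with
  | fix η x a => exact hw.2.subst hw ht.freeFor
  | and_left | or_left => exact hw.1
  | and_right | or_right => exact hw.2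
  | dia | box => exact hw

theorem reach_of_reflTransGen {p : MuForm V → Prop} {φ φ' : MuForm V}
    (h : Relation.ReflTransGen (fun α β => TraceStep α β ∧ p β) φ φ') : Reach φ φ' := by
  induction h with
  | refl => exact .refl
  | tail _ h ih => exact .tail ih h.1

theorem Reach.isTidy {φ φ' : MuForm V} (h : Reach φ φ') (ht : IsTidy φ) : IsTidy φ' := by
  induction h with
  | refl => exact ht
  | tail _ h ih => exact h.isTidy ih

theorem Reach.FV_BV_subset {φ φ' : MuForm V} (h : Reach φ φ') (ht : IsTidy φ) :
    FV φ' ⊆ FV φ ∧ BV φ' ⊆ BV φ := by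
  induction h with
  | refl => exact ⟨subset_rfl, subset_rfl⟩
  | tail hr h ih =>
    exact ⟨(h.FV_subset (Reach.isTidy hr ht)).trans ih.1, h.BV_subset.trans ih.2⟩

theorem FreeSub.eq_or_size_lt {ψ φ : MuForm V} (h : FreeSub ψ φ) :
    φ = ψ ∨ size ψ < size φ := by
  obtain ⟨a, x, -, hx, hf, rfl⟩ := h
  rcases eq_var_or_size_lt_subst (ψ := ψ) hf.1 hx with rfl | h
  · simp [subst]
  · exact Or.inr h

theorem ReachThrough.freeSub {ψ ρ σ : MuForm V} (h : ReachThrough ψ ρ σ) : FreeSub ψ σ := by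
  rcases Relation.ReflTransGen.cases_tail h.2 with h' | ⟨_, _, h'⟩
  · exact h' ▸ h.1
  · exact h'.2

theorem ClosLE.antisymm {φ ψ : MuForm V} (h : ClosLE φ ψ) (h' : ClosLE ψ φ) : φ = ψ := by
  rcases h.2.2.freeSub.eq_or_size_lt with e | e
  · exact e
  · rcases h'.2.2.freeSub.eq_or_size_lt with e' | e'
    · exact e'.symm
    · omega

end MuForm

namespace MuForm

variable {V : Type*}

/-! ### Descending paths in the syntax tree -/

/-- `Child φ Y a`: the formula `a` is an immediate subformula of `φ`, and `Y` is the set of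
variables bound by the outermost connective of `φ`. -/
inductive Child : MuForm V → Set V → MuForm V → Prop
  | and_left (a b : MuForm V) : Child (and a b) ∅ a
  | and_right (a b : MuForm V) : Child (and a b) ∅ b
  | or_left (a b : MuForm V) : Child (or a b) ∅ a
  | or_right (a b : MuForm V) : Child (or a b) ∅ b
  | dia (a : MuForm V) : Child (dia a) ∅ a
  | box (a : MuForm V) : Child (box a) ∅ a
  | fix (η : FixOp) (y : V) (a : MuForm V) : Child (fix η y a) {y} a

/-- `GuardedPath s X m a c`: there is a path of length `m` in the syntax tree of `a`, from the
root to an occurrence of `c`, such that, if `s` holds, every formula on it has a free variable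
in `X` or bound by an operator passed on the way. -/
inductive GuardedPath (s : Prop) : Set V → ℕ → MuForm V → MuForm V → Prop
  | refl {X : Set V} {a : MuForm V} : (s → (FV a ∩ X).Nonempty) → GuardedPath s X 0 a a
  | step {X Y : Set V} {m : ℕ} {a b c : MuForm V} : (s → (FV a ∩ X).Nonempty) →
      Child a Y b → GuardedPath s (X ∪ Y) m b c → GuardedPath s X (m + 1) a c

/-- `c` is a subformula of `a`. -/
def Subformula (c a : MuForm V) : Prop := ∃ m, GuardedPath False ∅ m a c

/-- `NestChain η n φ`: the `η`-formula `φ` is the outermost member of a sequence of `n` nested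
fixpoint formulas of alternating type, each of which depends on the next larger one. -/
inductive NestChain : FixOp → ℕ → MuForm V → Prop
  | single (η : FixOp) (x : V) (a : MuForm V) : NestChain η 1 (fix η x a)
  | cons {η : FixOp} {x : V} {a c : MuForm V} {m n : ℕ} : GuardedPath True {x} m a c →
      NestChain η.dual n c → NestChain η (n + 1) (fix η x a)

/-- All chains of nested fixpoint formulas in `φ` with outermost member of type `η` have length
at most `n`. -/
def NestBound (η : FixOp) (n : ℕ) (φ : MuForm V) : Prop :=
  ∀ c k, Subformula c φ → NestChain η k c → k ≤ n

theorem Child.FV_subset {a b : MuForm V} {Y : Set V} (h : Child a Y b) : FV b ⊆ FV a ∪ Y := by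
  cases h <;> intro v hv <;> simp only [FV, Set.mem_union, Set.mem_sdiff] <;> tauto

theorem Child.size_lt {a b : MuForm V} {Y : Set V} (h : Child a Y b) : size b < size a := by
  cases h <;> simp [size]

namespace GuardedPath

variable {s : Prop} {X X' : Set V} {m : ℕ} {a c : MuForm V}

theorem guard (h : GuardedPath s X m a c) (hs : s) : (FV a ∩ X).Nonempty := by
  cases h with
  | refl h => exact h hs
  | step h _ _ => exact h hs

theorem mono (h : GuardedPath s X m a c) (hX : s → FV a ∩ X ⊆ X') : GuardedPath s X' m a c := by
  induction h generalizing X' with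
  | refl h =>
    exact .refl fun hs => (h hs).mono fun v hv => ⟨hv.1, hX hs hv⟩
  | step h hc _ ih =>
    refine .step (fun hs => (h hs).mono fun v hv => ⟨hv.1, hX hs hv⟩) hc (ih fun hs v hv => ?_)
    rcases hv with ⟨hv, hv' | hv'⟩
    · rcases hc.FV_subset hv with hva | hvY
      · exact Or.inl (hX hs ⟨hva, hv'⟩)
      · exact Or.inr hvY
    · exact Or.inr hv'

theorem size_le (h : GuardedPath s X m a c) : size c ≤ size a := by
  induction h with
  | refl => exact le_rfl
  | step _ hc _ ih => exact ih.trans hc.size_lt.le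

theorem subformula (h : GuardedPath s X m a c) : Subformula c a := by
  refine ⟨m, ?_⟩
  have key : ∀ X', GuardedPath False X' m a c := by
    induction h with
    | refl => exact fun X' => .refl False.elim
    | step _ hc _ ih => exact fun X' => .step False.elim hc (ih _)
  exact key _

end GuardedPath

theorem Subformula.refl (a : MuForm V) : Subformula a a := ⟨0, .refl False.elim⟩

theorem Child.subformula {a b c : MuForm V} {Y : Set V} (h : Child a Y b)
    (hc : Subformula c b) : Subformula c a := by
  obtain ⟨m, hm⟩ := hc
  exact ⟨m + 1, .step False.elim h (hm.mono False.elim)⟩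

theorem Subformula.trans {a b c : MuForm V} (h : Subformula b a) (h' : Subformula c b) :
    Subformula c a := by
  obtain ⟨m, hm⟩ := h
  have : ∀ {X : Set V} {m : ℕ} {a b : MuForm V}, GuardedPath False X m a b →
      Subformula c b → Subformula c a := by
    intro X m a b h hc
    induction h with
    | refl => exact hc
    | step _ hch _ ih => exact hch.subformula (ih hc)
  exact this hm h'

theorem Subformula.cases_child {a c : MuForm V} (h : Subformula c a) :
    c = a ∨ ∃ Y b, Child a Y b ∧ Subformula c b := by
  obtain ⟨m, hm⟩ := h
  cases hm with
  | refl => exact Or.inl rfl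
  | step _ hc h => exact Or.inr ⟨_, _, hc, h.subformula⟩

theorem NestChain.isFixOf {η : FixOp} {k : ℕ} {c : MuForm V} (h : NestChain η k c) :
    IsFixOf η c := by
  cases h <;> exact ⟨_, _, rfl⟩

theorem NestChain.le_size {η : FixOp} {k : ℕ} {c : MuForm V} (h : NestChain η k c) :
    k ≤ size c := by
  induction h with
  | single => simp [size]
  | cons hp _ ih => have := hp.size_le; simp only [size]; omega

theorem NestBound.mono {η : FixOp} {n : ℕ} {a b : MuForm V} (h : NestBound η n a)
    (hb : Subformula b a) : NestBound η n b :=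
  fun _ _ hc => h _ _ (hb.trans hc)

theorem nestBound_size (η : FixOp) (φ : MuForm V) : NestBound η (size φ) φ := by
  rintro c k ⟨m, hm⟩ hk
  exact hk.le_size.trans hm.size_le

/-! ### Paths and substitution -/

variable [DecidableEq V]

theorem Child.of_subst {ψ a d : MuForm V} {z : V} {Y : Set V} (h : Child (subst ψ z a) Y d)
    (hf : FreeFor ψ z a) (ha : a ≠ var z) :
    ∃ b, Child a Y b ∧ ((z ∉ Y ∧ d = subst ψ z b ∧ FreeFor ψ z b ∧
      (z ∈ FV b → Disjoint Y (FV ψ))) ∨ (z ∈ Y ∧ d = b)) := by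
  obtain ⟨hp, hc⟩ := hf
  cases a with
  | top | bot | negvar => cases h
  | var p =>
    have hpz : ¬ p = z := fun e => ha (by rw [e])
    simp only [subst, hpz, if_false] at h
    cases h
  | and a b | or a b =>
    cases h
    · exact ⟨_, by constructor, Or.inl ⟨by simp, rfl, ⟨hp.1, hc.1⟩, by simp⟩⟩
    · exact ⟨_, by constructor, Or.inl ⟨by simp, rfl, ⟨hp.2, hc.2⟩, by simp⟩⟩
  | dia a | box a =>
    cases h
    exact ⟨_, by constructor, Or.inl ⟨by simp, rfl, ⟨hp, hc⟩, by simp⟩⟩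
  | fix η y a =>
    by_cases hy : y = z
    · simp only [subst, hy, if_true] at h
      cases h
      exact ⟨d, by rw [hy]; constructor, Or.inr ⟨rfl, rfl⟩⟩
    · simp only [subst, hy, if_false] at h
      cases h
      rcases hc with hc | hc
      · exact absurd hc hy
      · exact ⟨a, by constructor, Or.inl ⟨fun e => hy e.symm, rfl, ⟨hp, hc.1⟩,
          fun hz => Set.disjoint_singleton_left.2 (hc.2 hz)⟩⟩

theorem Child.subst {ψ a b : MuForm V} {z : V} {Y : Set V} (h : Child a Y b)
    (hf : FreeFor ψ z a) :
    (z ∉ Y ∧ Child (subst ψ z a) Y (subst ψ z b) ∧ FreeFor ψ z b) ∨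
      (z ∈ Y ∧ MuForm.subst ψ z a = a) := by
  obtain ⟨hp, hc⟩ := hf
  cases h with
  | and_left | or_left => exact Or.inl ⟨by simp, by constructor, hp.1, hc.1⟩
  | and_right | or_right => exact Or.inl ⟨by simp, by constructor, hp.2, hc.2⟩
  | dia | box => exact Or.inl ⟨by simp, by constructor, hp, hc⟩
  | fix η y a =>
    by_cases hy : y = z
    · exact Or.inr ⟨hy.symm, by simp [MuForm.subst, hy]⟩
    · rcases hc with hc | hc
      · exact absurd hc hy
      · refine Or.inl ⟨fun e => hy e.symm, ?_, hp, hc.1⟩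
        simp only [MuForm.subst, hy, if_false]
        constructor

namespace GuardedPath

variable {s : Prop} {X X' : Set V} {m : ℕ} {ψ a c : MuForm V} {z : V}

theorem of_subst (h : GuardedPath s X m (subst ψ z a) c) (hf : FreeFor ψ z a)
    (hX : s → X \ {z} ⊆ X') (hz : s → z ∈ FV a → (FV ψ ∩ X).Nonempty → z ∈ X') :
    (∃ c', GuardedPath s X' m a c' ∧ c' ≠ var z ∧ FreeFor ψ z c' ∧ c = subst ψ z c') ∨
      GuardedPath s X' m a c ∨ (z ∈ FV a ∧ ∃ m', GuardedPath s X m' ψ c) := by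
  generalize he : subst ψ z a = d at h
  have hg : s → (FV d ∩ X).Nonempty → (FV a ∩ X').Nonempty := by
    rintro hs ⟨v, hv, hvX⟩
    rw [← he, mem_FV_subst hf] at hv
    rcases hv with hv | hv
    · exact ⟨v, hv.1, hX hs ⟨hvX, hv.2⟩⟩
    · exact ⟨z, hv.1, hz hs hv.1 ⟨v, hv.2, hvX⟩⟩
  induction h generalizing a X' with
  | @refl X d hd =>
    by_cases ha : a = var z
    · subst ha
      simp only [subst, if_true] at he
      subst he
      exact Or.inr (Or.inr ⟨rfl, 0, .refl hd⟩)
    · exact Or.inl ⟨a, .refl fun hs => hg hs (hd hs), ha, hf, he.symm⟩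
  | @step X Y m d b c hd hch hp ih =>
    by_cases ha : a = var z
    · subst ha
      simp only [subst, if_true] at he
      subst he
      exact Or.inr (Or.inr ⟨rfl, m + 1, .step hd hch hp⟩)
    · subst he
      obtain ⟨b', hb', ⟨hzY, rfl, hf', hdis⟩ | ⟨hzY, rfl⟩⟩ := hch.of_subst hf ha
      · have hX1 : s → (X ∪ Y) \ {z} ⊆ X' ∪ Y := by
          rintro hs v ⟨hv | hv, hvz⟩
          · exact Or.inl (hX hs ⟨hv, hvz⟩)
          · exact Or.inr hv
        have hza : z ∈ FV b' → z ∈ FV a := fun h => (hb'.FV_subset h).resolve_right hzY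
        have hz1 : s → z ∈ FV b' → (FV ψ ∩ (X ∪ Y)).Nonempty → z ∈ X' ∪ Y := by
          rintro hs hzb ⟨v, hv, hvX | hvY⟩
          · exact Or.inl (hz hs (hza hzb) ⟨v, hv, hvX⟩)
          · exact absurd hv (Set.disjoint_left.1 (hdis hzb) hvY)
        have hg1 : s → (FV (subst ψ z b') ∩ (X ∪ Y)).Nonempty → (FV b' ∩ (X' ∪ Y)).Nonempty := by
          rintro hs ⟨v, hv, hvX⟩
          rw [mem_FV_subst hf'] at hv
          rcases hv with hv | hv
          · exact ⟨v, hv.1, hX1 hs ⟨hvX, hv.2⟩⟩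
          · exact ⟨z, hv.1, hz1 hs hv.1 ⟨v, hv.2, hvX⟩⟩
        rcases ih hf' hX1 hz1 rfl hg1 with ⟨c', hc', h1, h2, h3⟩ | h | ⟨hzb, m', h⟩
        · exact Or.inl ⟨c', .step (fun hs => hg hs (hd hs)) hb' hc', h1, h2, h3⟩
        · exact Or.inr (Or.inl (.step (fun hs => hg hs (hd hs)) hb' h))
        · refine Or.inr (Or.inr ⟨hza hzb, m', h.mono ?_⟩)
          rintro - v ⟨hv, hvX | hvY⟩
          · exact hvX
          · exact absurd hv (Set.disjoint_left.1 (hdis hzb) hvY)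
      · refine Or.inr (Or.inl (.step (fun hs => hg hs (hd hs)) hb' (hp.mono ?_)))
        rintro hs v ⟨-, hvX | hvY⟩
        · by_cases hvz : v = z
          · exact Or.inr (hvz ▸ hzY)
          · exact Or.inl (hX hs ⟨hvX, hvz⟩)
        · exact Or.inr hvY

theorem subst (h : GuardedPath s X m a c) (hf : FreeFor ψ z a) (hX : s → X \ {z} ⊆ X')
    (hz : s → z ∈ X → (FV ψ ∩ X').Nonempty) :
    (GuardedPath s X' m (subst ψ z a) (MuForm.subst ψ z c) ∧ FreeFor ψ z c) ∨
      GuardedPath s X' m (MuForm.subst ψ z a) c := by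
  have hg : ∀ {X X' : Set V} {a : MuForm V}, FreeFor ψ z a → (s → X \ {z} ⊆ X') →
      (s → z ∈ X → (FV ψ ∩ X').Nonempty) → (s → (FV a ∩ X).Nonempty) →
      s → (FV (MuForm.subst ψ z a) ∩ X').Nonempty := by
    intro X X' a hf hX hz h hs
    obtain ⟨v, hv, hvX⟩ := h hs
    by_cases hvz : v = z
    · subst hvz
      obtain ⟨w, hw, hwX⟩ := hz hs hvX
      exact ⟨w, (mem_FV_subst hf w).2 (Or.inr ⟨hv, hw⟩), hwX⟩
    · exact ⟨v, (mem_FV_subst hf v).2 (Or.inl ⟨hv, hvz⟩), hX hs ⟨hvX, hvz⟩⟩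
  induction h generalizing X' with
  | refl hd => exact Or.inl ⟨.refl (hg hf hX hz hd), hf⟩
  | @step X Y m a b c hd hch hp ih =>
    rcases hch.subst hf with ⟨hzY, hch', hf'⟩ | ⟨hzY, he⟩
    · have hX1 : s → (X ∪ Y) \ {z} ⊆ X' ∪ Y := by
        rintro hs v ⟨hv | hv, hvz⟩
        · exact Or.inl (hX hs ⟨hv, hvz⟩)
        · exact Or.inr hv
      have hz1 : s → z ∈ X ∪ Y → (FV ψ ∩ (X' ∪ Y)).Nonempty := fun hs h =>
        (hz hs (h.resolve_right hzY)).mono fun v hv => ⟨hv.1, Or.inl hv.2⟩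
      rcases ih hf' hX1 hz1 with ⟨h, h'⟩ | h
      · exact Or.inl ⟨.step (hg hf hX hz hd) hch' h, h'⟩
      · exact Or.inr (.step (hg hf hX hz hd) hch' h)
    · refine Or.inr (.step (hg hf hX hz hd) (he.symm ▸ hch) (hp.mono ?_))
      rintro hs v ⟨-, hvX | hvY⟩
      · by_cases hvz : v = z
        · exact Or.inr (hvz ▸ hzY)
        · exact Or.inl (hX hs ⟨hvX, hvz⟩)
      · exact Or.inr hvY

end GuardedPath

theorem NestChain.of_subst {η : FixOp} {k : ℕ} {ψ φ : MuForm V} {z : V}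
    (h : NestChain η k (subst ψ z φ)) (hf : FreeFor ψ z φ) (hφ : φ ≠ var z) :
    NestChain η k φ := by
  generalize he : subst ψ z φ = d at h
  induction h generalizing φ with
  | single η x a =>
    cases φ with
    | fix η' y b =>
      by_cases hy : y = z
      · simp only [subst, hy, if_true] at he
        rw [hy, he]; constructor
      · simp only [subst, hy, if_false, fix.injEq] at he
        rw [he.1]; constructor
    | var p =>
      have hpz : ¬ p = z := fun e => hφ (by rw [e])
      simp [subst, hpz] at he
    | _ => simp [subst] at he
  | @cons η x a c m n hp hc ih =>
    cases φ with
    | fix η' y b =>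
      by_cases hy : y = z
      · simp only [subst, hy, if_true] at he
        rw [hy, he]; exact .cons hp hc
      · simp only [subst, hy, if_false, fix.injEq] at he
        obtain ⟨rfl, rfl, rfl⟩ := he
        have hc' := hf.2.resolve_left hy
        have hn : z ∈ FV b → ¬ (FV ψ ∩ {y}).Nonempty := by
          rintro hz ⟨v, hv, rfl⟩
          exact hc'.2 hz hv
        rcases hp.of_subst (X' := {y}) ⟨hf.1, hc'.1⟩ (fun _ => Set.sdiff_subset)
          (fun _ hz h => absurd h (hn hz)) with ⟨c', h1, h2, h3, rfl⟩ | h | ⟨hz, m', h⟩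
        · exact .cons h1 (ih h3 h2 rfl)
        · exact .cons h hc
        · exact absurd (h.guard trivial) (hn hz)
    | var p =>
      have hpz : ¬ p = z := fun e => hφ (by rw [e])
      simp [subst, hpz] at he
    | _ => simp [subst] at he

theorem NestChain.subst {η : FixOp} {k : ℕ} {ψ φ : MuForm V} {z : V}
    (h : NestChain η k φ) (hf : FreeFor ψ z φ) : NestChain η k (subst ψ z φ) := by
  induction h with
  | single η x a =>
    by_cases hx : x = z <;> simp only [MuForm.subst, hx, if_true, if_false] <;> constructor
  | @cons η x a c m n hp hc ih =>
    by_cases hx : x = z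
    · simp only [MuForm.subst, hx, if_true]
      exact .cons (hx ▸ hp) hc
    · simp only [MuForm.subst, hx, if_false]
      rcases hp.subst (X' := {x}) ⟨hf.1, (hf.2.resolve_left hx).1⟩ (fun _ => Set.sdiff_subset)
        (fun _ hz => absurd hz.symm hx) with h | h
      · exact .cons h.1 (ih h.2)
      · exact .cons h hc

theorem NestBound.subst {η : FixOp} {n : ℕ} {ψ φ : MuForm V} {x : V} (hf : FreeFor ψ x φ)
    (hφ : NestBound η n φ) (hψ : NestBound η n ψ) : NestBound η n (subst ψ x φ) := by
  rintro c k ⟨m, hm⟩ hk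
  rcases hm.of_subst (X' := ∅) hf False.elim False.elim with ⟨c', h1, h2, h3, rfl⟩ | h | ⟨-, _, h⟩
  · exact hφ _ _ h1.subformula (hk.of_subst h3 h2)
  · exact hφ _ _ h.subformula hk
  · exact hψ _ _ h.subformula hk

theorem NestBound.of_subst {η : FixOp} {n : ℕ} {ψ φ : MuForm V} {x : V} (hf : FreeFor ψ x φ)
    (h : NestBound η n (MuForm.subst ψ x φ)) : NestBound η n φ := by
  rintro c k ⟨m, hm⟩ hk
  rcases hm.subst (X' := ∅) hf False.elim False.elim with ⟨h1, h2⟩ | h1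
  · exact h _ _ h1.subformula (hk.subst h2)
  · exact h _ _ h1.subformula hk

end MuForm

namespace MuForm

variable {V : Type*}

/-! ### The alternation hierarchy in terms of nested chains -/

theorem nestBound_of_child {η : FixOp} {n : ℕ} {a : MuForm V} (ha : ¬ IsFixOf η a)
    (h : ∀ Y b, Child a Y b → NestBound η n b) : NestBound η n a := by
  intro c k hc hk
  rcases hc.cases_child with rfl | ⟨Y, b, hb, hc⟩
  · exact absurd hk.isFixOf ha
  · exact h Y b hb _ _ hc hk

/-- Every non-atomic subformula of `a` is reached by a path guarded by `X`. -/
def AllGuarded (X : Set V) (a : MuForm V) : Prop :=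
  ∀ c, Subformula c a → ¬ IsAtomic c → ∃ m, GuardedPath True X m a c

theorem allGuarded_of_child {X : Set V} {a : MuForm V} (hg : (FV a ∩ X).Nonempty)
    (h : ∀ Y b, Child a Y b → AllGuarded (X ∪ Y) b) : AllGuarded X a := by
  intro c hc hca
  rcases hc.cases_child with rfl | ⟨Y, b, hb, hc⟩
  · exact ⟨0, .refl fun _ => hg⟩
  · obtain ⟨m, hm⟩ := h Y b hb c hc hca
    exact ⟨m + 1, .step (fun _ => hg) hb hm⟩

theorem allGuarded_of_isAtomic (X : Set V) {a : MuForm V} (ha : IsAtomic a) :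
    AllGuarded X a := by
  intro c hc hca
  rcases hc.cases_child with rfl | ⟨Y, b, hb, -⟩
  · exact absurd ha hca
  · cases hb <;> exact ha.elim

theorem one_lt_size {a : MuForm V} (ha : ¬ IsAtomic a) : 1 < size a := by
  cases a <;> simp_all [IsAtomic, size] <;> rename_i a <;> cases a <;> simp [size]

theorem NoCapture.of_notMem {ψ : MuForm V} {x : V} {φ : MuForm V} (h : x ∉ FV φ) :
    NoCapture ψ x φ := by
  induction φ with
  | fix η y a ih =>
    simp only [FV, Set.mem_sdiff, Set.mem_singleton_iff, not_and, not_not] at h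
    by_cases hx : x ∈ FV a
    · exact Or.inl (h hx).symm
    · exact Or.inr ⟨ih hx, fun h => absurd h hx⟩
  | _ => simp_all [FV, NoCapture]

theorem Subformula.wf {a c : MuForm V} (h : Subformula c a) (hw : WF a) : WF c := by
  obtain ⟨m, hm⟩ := h
  generalize (∅ : Set V) = X at hm
  induction hm with
  | refl => exact hw
  | step _ hch _ ih => exact ih (by cases hch <;> simp_all [WF])

variable [DecidableEq V]

/-- `Detachable X z a`: a non-atomic subformula of `a` that does not depend on `X` can be cut
off, leaving the variable `z` in its place. -/
def Detachable (X : Set V) (z : V) (a : MuForm V) : Prop :=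
  ∃ a' θ, a = subst θ z a' ∧ Subformula θ a ∧ FreeFor θ z a' ∧ WF a' ∧
    size a' < size a ∧ Disjoint (FV θ) X ∧ (∀ y, PosIn y a → PosIn y a')

theorem AH.nestBound {η : FixOp} {n : ℕ} {φ : MuForm V} (h : AH η n φ) : NestBound η n φ := by
  induction h with
  | atom η h =>
    rename_i φ
    cases φ <;> first
      | exact h.elim
      | exact nestBound_of_child (by simp [IsFixOf]) (by rintro Y b ⟨⟩)
  | and _ _ iha ihb | or _ _ iha ihb =>
    exact nestBound_of_child (by simp [IsFixOf]) (by rintro Y b ⟨⟩ <;> assumption)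
  | dia _ ih | box _ ih =>
    exact nestBound_of_child (by simp [IsFixOf]) (by rintro Y b ⟨⟩; exact ih)
  | @fix η n a x _ _ ih =>
    refine nestBound_of_child ?_ (by rintro Y b ⟨⟩; exact ih)
    rintro ⟨_, _, h⟩
    simp only [MuForm.fix.injEq] at h
    exact η.dual_ne h.1
  | subst x hf _ _ ihφ ihψ => exact ihφ.subst hf ihψ
  | @lift η' n φ η _ ih =>
    intro c k hc hk
    rcases η'.eq_or_eq_dual η with rfl | rfl
    · exact (ih _ _ hc hk).trans (Nat.le_succ n)
    · cases hk with
      | single => omega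
      | cons hp hk =>
        rw [FixOp.dual_dual] at hk
        have := ih _ _ (hc.trans ((Child.fix _ _ _).subformula hp.subformula)) hk
        omega

theorem AH.of_isAtomic {η : FixOp} {φ : MuForm V} (h : IsAtomic φ) (n : ℕ) : AH η n φ := by
  induction n with
  | zero => exact .atom η h
  | succ n ih => exact .lift η ih

theorem allGuarded_or_detachable {X : Set V} {z : V} {a : MuForm V} (hw : WF a)
    (hz : z ∉ FV a) (hz' : z ∉ BV a) : AllGuarded X a ∨ Detachable X z a := by
  have unguarded : ∀ {X : Set V} {a : MuForm V}, ¬ (FV a ∩ X).Nonempty → ¬ IsAtomic a →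
      Detachable X z a := by
    intro X a hg ha
    exact ⟨var z, a, by simp [subst], .refl a, ⟨trivial, trivial⟩, trivial,
      one_lt_size ha, Set.disjoint_iff_inter_eq_empty.2 (Set.not_nonempty_iff_eq_empty.1 hg),
      fun _ _ => trivial⟩
  induction a generalizing X with
  | top | bot | var | negvar => exact Or.inl (allGuarded_of_isAtomic X trivial)
  | and a b iha ihb =>
    by_cases hg : (FV (MuForm.and a b) ∩ X).Nonempty
    swap
    · exact Or.inr (unguarded hg not_false)
    simp only [FV, BV, Set.mem_union, not_or] at hz hz'
    rcases iha (X := X) hw.1 hz.1 hz'.1 with ha | ⟨a', θ, h1, h2, h3, h4, h5, h6, h7⟩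
    · rcases ihb (X := X) hw.2 hz.2 hz'.2 with hb | ⟨b', θ, h1, h2, h3, h4, h5, h6, h7⟩
      · left
        apply allGuarded_of_child hg
        rintro Y d ⟨⟩ <;> simpa
      · refine Or.inr ⟨and a b', θ, ?_, (Child.and_right _ _).subformula h2,
          ⟨⟨posIn_of_fresh hz.1 hz'.1, h3.1⟩, NoCapture.of_notMem hz.1, h3.2⟩, ⟨hw.1, h4⟩, ?_, h6,
          fun y hy => ⟨hy.1, h7 y hy.2⟩⟩
        · rw [subst, subst_of_notMem hz.1, ← h1]
        · simp only [size]; omega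
    · refine Or.inr ⟨and a' b, θ, ?_, (Child.and_left _ _).subformula h2,
        ⟨⟨h3.1, posIn_of_fresh hz.2 hz'.2⟩, h3.2, NoCapture.of_notMem hz.2⟩, ⟨h4, hw.2⟩, ?_, h6,
        fun y hy => ⟨h7 y hy.1, hy.2⟩⟩
      · rw [subst, subst_of_notMem hz.2, ← h1]
      · simp only [size]; omega
  | or a b iha ihb =>
    by_cases hg : (FV (MuForm.or a b) ∩ X).Nonempty
    swap
    · exact Or.inr (unguarded hg not_false)
    simp only [FV, BV, Set.mem_union, not_or] at hz hz'
    rcases iha (X := X) hw.1 hz.1 hz'.1 with ha | ⟨a', θ, h1, h2, h3, h4, h5, h6, h7⟩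
    · rcases ihb (X := X) hw.2 hz.2 hz'.2 with hb | ⟨b', θ, h1, h2, h3, h4, h5, h6, h7⟩
      · left
        apply allGuarded_of_child hg
        rintro Y d ⟨⟩ <;> simpa
      · refine Or.inr ⟨or a b', θ, ?_, (Child.or_right _ _).subformula h2,
          ⟨⟨posIn_of_fresh hz.1 hz'.1, h3.1⟩, NoCapture.of_notMem hz.1, h3.2⟩, ⟨hw.1, h4⟩, ?_, h6,
          fun y hy => ⟨hy.1, h7 y hy.2⟩⟩
        · rw [subst, subst_of_notMem hz.1, ← h1]
        · simp only [size]; omega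
    · refine Or.inr ⟨or a' b, θ, ?_, (Child.or_left _ _).subformula h2,
        ⟨⟨h3.1, posIn_of_fresh hz.2 hz'.2⟩, h3.2, NoCapture.of_notMem hz.2⟩, ⟨h4, hw.2⟩, ?_, h6,
        fun y hy => ⟨h7 y hy.1, hy.2⟩⟩
      · rw [subst, subst_of_notMem hz.2, ← h1]
      · simp only [size]; omega
  | dia a ih =>
    by_cases hg : (FV (MuForm.dia a) ∩ X).Nonempty
    swap
    · exact Or.inr (unguarded hg not_false)
    rcases ih (X := X) hw hz hz' with ha | ⟨a', θ, h1, h2, h3, h4, h5, h6, h7⟩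
    · left
      apply allGuarded_of_child hg
      rintro Y d ⟨⟩
      simpa
    · refine Or.inr ⟨dia a', θ, by rw [subst, ← h1], (Child.dia _).subformula h2, h3, h4, ?_, h6,
        h7⟩
      simp only [size]; omega
  | box a ih =>
    by_cases hg : (FV (MuForm.box a) ∩ X).Nonempty
    swap
    · exact Or.inr (unguarded hg not_false)
    rcases ih (X := X) hw hz hz' with ha | ⟨a', θ, h1, h2, h3, h4, h5, h6, h7⟩
    · left
      apply allGuarded_of_child hg
      rintro Y d ⟨⟩
      simpa
    · refine Or.inr ⟨box a', θ, by rw [subst, ← h1], (Child.box _).subformula h2, h3, h4, ?_, h6,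
        h7⟩
      simp only [size]; omega
  | fix η y a ih =>
    by_cases hg : (FV (MuForm.fix η y a) ∩ X).Nonempty
    swap
    · exact Or.inr (unguarded hg not_false)
    simp only [FV, BV, Set.mem_sdiff, Set.mem_insert_iff, not_or, Set.mem_singleton_iff] at hz hz'
    have hyz : ¬ y = z := fun e => hz'.1 e.symm
    rcases ih (X := X ∪ {y}) hw.2 (fun h => hz ⟨h, hz'.1⟩) hz'.2 with
      ha | ⟨a', θ, h1, h2, h3, h4, h5, h6, h7⟩
    · left
      apply allGuarded_of_child hg
      rintro Y d ⟨⟩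
      exact ha
    · rw [Set.disjoint_union_right, Set.disjoint_singleton_right] at h6
      refine Or.inr ⟨fix η y a', θ, ?_, (Child.fix _ _ _).subformula h2,
        ⟨h3.1, Or.inr ⟨h3.2, fun _ => h6.2⟩⟩, ⟨h7 y hw.1, h4⟩, ?_, h6.1, h7⟩
      · simp only [subst, hyz, if_false]
        rw [← h1]
      · simp only [size]; omega

theorem ah_of_nestBound [Infinite V] {ξ : MuForm V} (hw : WF ξ) {η : FixOp} {n : ℕ}
    (h : NestBound η n ξ) : AH η n ξ := by
  induction hN : size ξ using Nat.strong_induction_on generalizing ξ η n with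
  | _ N ih =>
    subst hN
    have sub : ∀ {Y b}, Child ξ Y b → WF b → AH η n b := fun hb hwb =>
      ih _ hb.size_lt hwb (h.mono (hb.subformula (.refl _))) rfl
    cases ξ with
    | top | bot | var | negvar => exact .of_isAtomic (by trivial) n
    | and a b => exact .and (sub (.and_left _ _) hw.1) (sub (.and_right _ _) hw.2)
    | or a b => exact .or (sub (.or_left _ _) hw.1) (sub (.or_right _ _) hw.2)
    | dia a => exact .dia (sub (.dia _) hw)
    | box a => exact .box (sub (.box _) hw)
    | fix η' x a =>
      rcases η.eq_or_eq_dual η' with rfl | rfl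
      swap
      · exact .fix x hw.1 (sub (.fix _ _ _) hw.2)
      obtain ⟨n, rfl⟩ : ∃ n', n = n' + 1 :=
        ⟨n - 1, by have := h _ _ (.refl _) (.single _ _ _); omega⟩
      obtain ⟨z, hz, hz'⟩ := exists_fresh (MuForm.fix η' x a)
      simp only [FV, BV, Set.mem_sdiff, Set.mem_insert_iff, not_or, Set.mem_singleton_iff]
        at hz hz'
      have hxz : ¬ x = z := fun e => hz'.1 e.symm
      rcases allGuarded_or_detachable (X := {x}) hw.2 (fun h => hz ⟨h, hz'.1⟩) hz'.2 with
        ha | ⟨a', θ, h1, h2, h3, h4, h5, h6, h7⟩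
      · have hb : NestBound η'.dual n a := by
          intro c k hc hk
          obtain ⟨m, hm⟩ := ha c hc (by obtain ⟨_, _, rfl⟩ := hk.isFixOf; exact not_false)
          have := h _ _ (.refl _) (.cons hm hk)
          omega
        have := AH.fix x hw.1 (ih _ (Child.fix η' x a).size_lt hw.2 hb rfl)
        rw [FixOp.dual_dual] at this
        exact .lift _ this
      · have hf : FreeFor θ z (fix η' x a') :=
          ⟨h3.1, Or.inr ⟨h3.2, fun _ => Set.disjoint_singleton_right.1 h6⟩⟩
        have e : fix η' x a = subst θ z (fix η' x a') := by
          simp only [subst, hxz, if_false]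
          rw [← h1]
        have hθ : Subformula θ (fix η' x a) := (Child.fix _ _ _).subformula h2
        have hw' : WF (fix η' x a') := ⟨h7 x hw.1, h4⟩
        have hA := ih (size (fix η' x a')) (by simp only [size]; omega) hw'
          (NestBound.of_subst hf (e ▸ h)) rfl
        have hθs : size θ < size (fix η' x a) := by
          obtain ⟨m, hm⟩ := h2
          have := hm.size_le
          simp only [size]; omega
        have hB := ih (size θ) hθs (hθ.wf hw) (h.mono hθ) rfl
        rw [e]
        exact .subst z hf hA hB

end MuForm

namespace MuForm

variable {V : Type*}

/-! ### Replacing a fixpoint formula by a variable -/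

open Classical in
/-- Replaces all occurrences of the fixpoint formula `ψ` by the variable `z`. -/
noncomputable def abstr (ψ : MuForm V) (z : V) : MuForm V → MuForm V
  | top => top
  | bot => bot
  | var p => var p
  | negvar p => negvar p
  | and a b => and (abstr ψ z a) (abstr ψ z b)
  | or a b => or (abstr ψ z a) (abstr ψ z b)
  | dia a => dia (abstr ψ z a)
  | box a => box (abstr ψ z a)
  | fix η y a => if fix η y a = ψ then var z else fix η y (abstr ψ z a)

variable {ψ : MuForm V} {z : V}

theorem abstr_self (h : IsFix ψ) : abstr ψ z ψ = var z := by
  obtain ⟨η, x, b, rfl⟩ := h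
  simp [abstr]

theorem FV_abstr_subset (a : MuForm V) : FV (abstr ψ z a) ⊆ FV a ∪ {z} := by
  induction a with
  | fix η y a ih =>
    by_cases h : fix η y a = ψ
    · simp [abstr, h, FV]
    · simp only [abstr, h, if_false, FV]
      rintro v ⟨hv, hvy⟩
      exact (ih hv).imp (fun h => ⟨h, hvy⟩) id
  | and a b iha ihb | or a b iha ihb =>
    rintro v (hv | hv)
    · exact (iha hv).imp Or.inl id
    · exact (ihb hv).imp Or.inr id
  | dia a ih | box a ih => exact ih
  | _ => simp [abstr, FV]

theorem BV_abstr_subset (a : MuForm V) : BV (abstr ψ z a) ⊆ BV a := by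
  induction a with
  | fix η y a ih =>
    by_cases h : fix η y a = ψ
    · simp [abstr, h, BV]
    · simp only [abstr, h, if_false, BV]
      exact Set.insert_subset_insert ih
  | and a b iha ihb | or a b iha ihb => exact Set.union_subset_union iha ihb
  | dia a ih | box a ih => exact ih
  | _ => simp [abstr, BV]

theorem PosIn.abstr {v : V} {a : MuForm V} (h : PosIn v a) : PosIn v (abstr ψ z a) := by
  induction a with
  | fix η y a ih =>
    by_cases hψ : fix η y a = ψ
    · simp [MuForm.abstr, hψ, PosIn]
    · simpa [MuForm.abstr, hψ, PosIn] using ih h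
  | _ => simp_all [MuForm.abstr, PosIn]

theorem abstr_of_size_lt {a : MuForm V} (h : size a < size ψ) : abstr ψ z a = a := by
  induction a with
  | fix η y a ih =>
    have hψ : ¬ fix η y a = ψ := by rintro rfl; omega
    simp only [size] at h
    simp only [abstr, hψ, if_false]
    rw [ih (by omega)]
  | and a b iha ihb | or a b iha ihb =>
    simp only [size] at h
    simp only [abstr]
    rw [iha (by omega), ihb (by omega)]
  | dia a ih | box a ih =>
    simp only [size] at h
    simp only [abstr]
    rw [ih (by omega)]
  | _ => rfl

variable [DecidableEq V]

theorem size_le_subst {ψ : MuForm V} {x : V} {φ : MuForm V} (hp : PosIn x φ)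
    (hx : x ∈ FV φ) : size ψ ≤ size (subst ψ x φ) := by
  rcases eq_var_or_size_lt_subst (ψ := ψ) hp hx with rfl | h
  · simp [subst]
  · exact h.le

theorem subst_abstr {a : MuForm V} (hz : z ∉ FV a) (hz' : z ∉ BV a) :
    subst ψ z (abstr ψ z a) = a := by
  induction a with
  | fix η y a ih =>
    simp only [FV, BV, Set.mem_sdiff, Set.mem_insert_iff, not_or, Set.mem_singleton_iff] at hz hz'
    by_cases h : fix η y a = ψ
    · simp [abstr, h, subst]
    · have hyz : ¬ y = z := fun e => hz'.1 e.symm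
      simp only [abstr, h, if_false, subst, hyz]
      rw [ih (fun h => hz ⟨h, hz'.1⟩) hz'.2]
  | var p =>
    have hp : ¬ p = z := fun e => hz e.symm
    simp [abstr, subst, hp]
  | _ => simp_all [abstr, subst, FV, BV]

theorem FreeSub.mem_FV_abstr (hψ : IsFix ψ) {ρ : MuForm V} (h : FreeSub ψ ρ) (hz : z ∉ BV ρ) :
    z ∈ FV (abstr ψ z ρ) := by
  obtain ⟨a, x, -, hx, ⟨hp, -⟩, rfl⟩ := h
  induction a with
  | top | bot => simp [FV] at hx
  | var p =>
    simp only [FV, Set.mem_singleton_iff] at hx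
    simp [subst, hx, abstr_self hψ, FV]
  | negvar p =>
    simp only [FV, Set.mem_singleton_iff] at hx
    exact absurd hx.symm hp
  | and a b iha ihb | or a b iha ihb =>
    simp only [subst, BV, Set.mem_union, not_or] at hz
    rcases hx with hx | hx
    · exact Or.inl (iha hx hp.1 hz.1)
    · exact Or.inr (ihb hx hp.2 hz.2)
  | dia a ih | box a ih => exact ih hx hp hz
  | fix η y a ih =>
    have hyx : ¬ y = x := fun e => hx.2 e.symm
    simp only [subst, hyx, if_false, BV, Set.mem_insert_iff, not_or] at hz ⊢
    by_cases h : fix η y (subst ψ x a) = ψ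
    · simp [abstr, h, FV]
    · simp only [abstr, h, if_false]
      exact ⟨ih hx.1 hp hz.2, hz.1⟩

theorem abstr_subst {ρ a : MuForm V} {y : V} (hyz : y ≠ z) (hy : y ∉ FV ψ)
    (hs : size ψ < size ρ) (hp : PosIn y a) :
    abstr ψ z (subst ρ y a) = subst (abstr ψ z ρ) y (abstr ψ z a) := by
  induction a with
  | var p => by_cases h : p = y <;> simp [subst, abstr, h]
  | fix η w a ih =>
    by_cases hya : y ∈ FV (fix η w a)
    · have hwy : ¬ w = y := fun e => hya.2 e.symm
      have h1 : ¬ fix η w a = ψ := fun e => hy (e ▸ hya)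
      have h2 : ¬ fix η w (subst ρ y a) = ψ := by
        have := size_le_subst (ψ := ρ) (show PosIn y a from hp) hya.1
        rintro rfl
        simp only [size] at hs
        omega
      simp only [subst, hwy, if_false, abstr, h1, h2]
      rw [ih hp]
    · rw [subst_of_notMem hya, subst_of_notMem]
      intro h
      rcases FV_abstr_subset _ h with h | h
      · exact hya h
      · exact hyz h
  | _ => simp_all [subst, abstr, PosIn]

theorem abstr_subst_self {a : MuForm V} {x : V} (hψ : IsFix ψ) (hs : size a < size ψ)
    (hp : PosIn x a) : abstr ψ z (subst ψ x a) = subst (var z) x a := by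
  induction a with
  | var p =>
    by_cases h : p = x <;> simp [subst, h, abstr_self hψ, abstr]
  | fix η w a ih =>
    by_cases hxa : x ∈ FV (fix η w a)
    · have hwx : ¬ w = x := fun e => hxa.2 e.symm
      have h2 : ¬ fix η w (subst ψ x a) = ψ := by
        have := size_le_subst (ψ := ψ) (show PosIn x a from hp) hxa.1
        intro e
        have e' := congrArg size e
        simp only [size] at e'
        omega
      simp only [size] at hs
      simp only [subst, hwx, if_false, abstr, h2]
      rw [ih (by omega) hp]
    · rw [subst_of_notMem hxa, subst_of_notMem hxa, abstr_of_size_lt hs]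
  | and a b iha ihb | or a b iha ihb =>
    simp only [size] at hs
    simp only [subst, abstr]
    rw [iha (by omega) hp.1, ihb (by omega) hp.2]
  | dia a ih | box a ih =>
    simp only [size] at hs
    simp only [subst, abstr]
    rw [ih (by omega) hp]
  | _ => rfl

/-! ### From chains in the closure to nested chains -/

theorem GuardedPath.of_unfold {s : Prop} {η η' : FixOp} {y z : V} {a c : MuForm V} {m k : ℕ}
    (hf : FreeFor (fix η y a) y a) (hz : z ∈ FV (fix η y a))
    (h : GuardedPath s {z} m (MuForm.subst (fix η y a) y a) c) (hc : NestChain η' k c) :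
    ∃ c' m', GuardedPath s {z} m' (fix η y a) c' ∧ NestChain η' k c' := by
  have hg : s → (FV (fix η y a) ∩ {z}).Nonempty := fun _ => ⟨z, hz, rfl⟩
  rcases h.of_subst (X' := {z} ∪ {y}) hf (fun _ v hv => Or.inl hv.1)
    (fun _ _ _ => Or.inr rfl) with ⟨c', h1, h2, h3, rfl⟩ | h | ⟨-, m', h⟩
  · exact ⟨c', _, .step hg (.fix _ _ _) h1, hc.of_subst h3 h2⟩
  · exact ⟨c, _, .step hg (.fix _ _ _) h, hc⟩
  · exact ⟨c, m', h, hc⟩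

theorem ReachThrough.exists_guardedPath {η : FixOp} {x : V} {b ρ : MuForm V}
    (ht : IsTidy (fix η x b)) (hz : z ∉ FV (fix η x b)) (hz' : z ∉ BV (fix η x b))
    (h : ReachThrough (fix η x b) (fix η x b) ρ) {c : MuForm V} {η' : FixOp} {k m : ℕ}
    (hm : GuardedPath True {z} m (abstr (fix η x b) z ρ) c) (hc : NestChain η' k c) :
    ∃ c' m', GuardedPath True {x} m' b c' ∧ NestChain η' k c' := by
  set ψ := fix η x b with hψ
  have hfix : IsFix ψ := ⟨η, x, b, rfl⟩
  obtain ⟨h0, h⟩ := h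
  induction h generalizing c m with
  | refl =>
    rw [abstr_self hfix] at hm
    cases hm with
    | refl => cases hc
    | step _ hch _ => cases hch
  | @tail ρ σ hρ hst ih =>
    have hρr : Reach ψ ρ := reach_of_reflTransGen hρ
    have hρt := hρr.isTidy ht
    have hρB := (hρr.FV_BV_subset ht).2
    have hρψ : FreeSub ψ ρ := ReachThrough.freeSub ⟨h0, hρ⟩
    obtain ⟨hstep, hσψ⟩ := hst
    have hzF : z ∈ FV (abstr ψ z ρ) := hρψ.mem_FV_abstr hfix fun h => hz' (hρB h)
    have hg : True → (FV (abstr ψ z ρ) ∩ {z}).Nonempty := fun _ => ⟨z, hzF, rfl⟩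
    by_cases hρe : ρ = ψ
    · rw [hρe, hψ] at hstep
      cases hstep
      rw [← hψ, abstr_subst_self hfix (by simp [hψ, size]) ht.wf.1] at hm
      have hzb : FreeFor (var z) x b :=
        ⟨ht.wf.1, noCapture_of_disjoint (Set.disjoint_singleton_left.2 fun h => hz' (Or.inr h))⟩
      have hmono : True → FV b ∩ {x, z} ⊆ {x} := by
        rintro - v ⟨hv, rfl | rfl⟩
        · rfl
        · by_contra hvx
          exact hz ⟨hv, hvx⟩
      rcases hm.of_subst (X' := {x, z}) hzb (fun _ v hv => Or.inr hv.1)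
        (fun _ _ _ => Or.inl rfl) with ⟨c', h1, h2, h3, rfl⟩ | h | ⟨-, m', h⟩
      · exact ⟨c', m, h1.mono hmono, hc.of_subst h3 h2⟩
      · exact ⟨c, m, h.mono hmono, hc⟩
      · cases h with
        | refl => cases hc
        | step _ hch _ => cases hch
    · cases hstep with
      | and_left | or_left | and_right | or_right | dia | box =>
        exact ih hc (.step hg (by constructor) (hm.mono fun _ _ hv => Or.inl hv.2))
      | fix η₁ y a =>
        have hlt : size ψ < size (fix η₁ y a) := hρψ.eq_or_size_lt.resolve_left hρe
        have hyB : y ∈ BV ψ := hρB (Or.inl rfl)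
        have hyz : y ≠ z := fun e => hz' (e ▸ hyB)
        have hyψ : y ∉ FV ψ := fun h => Set.disjoint_left.1 ht.disj h hyB
        rw [abstr_subst hyz hyψ hlt hρt.wf.1] at hm
        have e : abstr ψ z (fix η₁ y a) = fix η₁ y (abstr ψ z a) := by simp [abstr, hρe]
        have hdis : Disjoint (FV (fix η₁ y (abstr ψ z a))) (BV (abstr ψ z a)) := by
          rw [← e]
          refine Set.disjoint_left.2 fun v hv hv' => ?_
          have hv'' : v ∈ BV (fix η₁ y a) := Or.inr (BV_abstr_subset _ hv')
          rcases FV_abstr_subset _ hv with h | h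
          · exact Set.disjoint_left.1 hρt.disj h hv''
          · exact hz' (hρB (h ▸ hv''))
        rw [e] at hm hzF
        obtain ⟨c', m', h1, h2⟩ := hm.of_unfold
          ⟨PosIn.abstr hρt.wf.1, noCapture_of_disjoint hdis⟩ hzF hc
        exact ih h2 (e ▸ h1)

theorem ClosLE.nestChain [Infinite V] {η : FixOp} {φ ψ : MuForm V} {k : ℕ} (h : ClosLE φ ψ)
    (ht : IsTidy ψ) (hψ : IsFixOf η ψ) (hφ : NestChain η.dual k φ) : NestChain η (k + 1) ψ := by
  obtain ⟨x, b, rfl⟩ := hψ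
  obtain ⟨z, hz, hz'⟩ := exists_fresh (fix η x b)
  obtain ⟨-, hψ, h⟩ := h
  have hne : ¬ φ = fix η x b := by
    rintro rfl
    obtain ⟨_, _, e⟩ := hφ.isFixOf
    simp only [fix.injEq] at e
    exact η.dual_ne e.1.symm
  have hr : Reach (fix η x b) φ := reach_of_reflTransGen h.2
  obtain ⟨hF, hB⟩ := hr.FV_BV_subset ht
  have hf : FreeFor (fix η x b) z (abstr (fix η x b) z φ) :=
    ⟨(posIn_of_fresh (fun h => hz (hF h)) fun h => hz' (hB h)).abstr,
      noCapture_of_disjoint (ht.disj.mono_right ((BV_abstr_subset _).trans hB))⟩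
  have hφ' : NestChain η.dual k (abstr (fix η x b) z φ) := by
    refine NestChain.of_subst (z := z) (ψ := fix η x b) ?_ hf ?_
    · rwa [subst_abstr (fun h => hz (hF h)) fun h => hz' (hB h)]
    · obtain ⟨y, a, rfl⟩ := hφ.isFixOf
      simp [abstr, hne]
  obtain ⟨c, m, hm, hc⟩ := h.exists_guardedPath ht hz hz'
    (.refl fun _ => ⟨z, h.freeSub.mem_FV_abstr hψ fun h => hz' (hB h), rfl⟩) hφ'
  exact .cons hm hc

theorem NestBound.of_reach {η : FixOp} {n : ℕ} {ξ φ : MuForm V} (hb : NestBound η n ξ)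
    (ht : IsTidy ξ) (h : Reach ξ φ) : NestBound η n φ := by
  induction h with
  | refl => exact hb
  | @tail ρ σ hρ hst ih =>
    have hρt := Reach.isTidy hρ ht
    cases hst with
    | fix η' x a =>
      exact (ih.mono ((Child.fix _ _ _).subformula (.refl _))).subst hρt.freeFor ih
    | _ => exact ih.mono (Child.subformula (by constructor) (.refl _))

theorem IsAltChain.nestChain [Infinite V] {c : List (MuForm V)} {φ : MuForm V} {η : FixOp}
    (hc : IsAltChain (c ++ [φ])) (hφ : IsFixOf η φ) : NestChain η (c.length + 1) φ := by
  induction c using List.reverseRecOn generalizing φ η with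
  | nil => obtain ⟨x, a, rfl⟩ := hφ; exact .single _ _ _
  | append_singleton c ψ ih =>
    obtain ⟨h1, h2⟩ := hc
    rw [List.isChain_append] at h2
    obtain ⟨hlt, η', hψ, hη'⟩ := h2.2.2 ψ (by simp) φ (by simp)
    obtain rfl : η = η'.dual := by
      obtain ⟨_, _, rfl⟩ := hφ
      obtain ⟨_, _, e⟩ := hη'
      simp only [fix.injEq] at e
      exact e.1
    have := ih ⟨fun θ hθ => h1 θ (List.mem_append_left _ hθ), h2.1⟩ hψ
    rw [← FixOp.dual_dual η'] at this
    simpa using hlt.1.nestChain (h1 φ (by simp)).1 hφ this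

end MuForm

namespace MuForm

variable {V : Type*}

/-! ### From nested chains to chains in the closure -/

theorem exists_guardedPath_var {z : V} {φ : MuForm V} (hp : PosIn z φ) (hz : z ∈ FV φ) :
    ∃ m, GuardedPath True {z} m φ (var z) := by
  have step : ∀ {φ b : MuForm V} {Y : Set V}, z ∈ FV φ → Child φ Y b →
      (∃ m, GuardedPath True {z} m b (var z)) → ∃ m, GuardedPath True {z} m φ (var z) := by
    rintro φ b Y hz hch ⟨m, hm⟩
    exact ⟨m + 1, .step (fun _ => ⟨z, hz, rfl⟩) hch (hm.mono fun _ v hv => Or.inl hv.2)⟩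
  induction φ with
  | top | bot => simp [FV] at hz
  | negvar p => exact absurd (show z = p from hz).symm hp
  | var p =>
    obtain rfl : z = p := hz
    exact ⟨0, .refl fun _ => ⟨z, rfl, rfl⟩⟩
  | and a b iha ihb =>
    rcases id hz with h | h
    · exact step hz (.and_left _ _) (iha hp.1 h)
    · exact step hz (.and_right _ _) (ihb hp.2 h)
  | or a b iha ihb =>
    rcases id hz with h | h
    · exact step hz (.or_left _ _) (iha hp.1 h)
    · exact step hz (.or_right _ _) (ihb hp.2 h)
  | dia a ih => exact step hz (.dia _) (ih hp hz)
  | box a ih => exact step hz (.box _) (ih hp hz)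
  | fix η y a ih => exact step hz (.fix _ _ _) (ih hp hz.1)

variable [DecidableEq V]

/-- A path in the syntax tree is followed by a trace, along which properties that are stable
under substitution are preserved. -/
theorem GuardedPath.exists_trace {s : Prop} {Q : MuForm V → Prop} {z : V}
    (hQ : ∀ χ y c, (s → y ≠ z) → FreeFor χ y c → Q c → Q (MuForm.subst χ y c))
    {m : ℕ} {ρ c : MuForm V} (ht : IsTidy ρ) (h : GuardedPath s {z} m ρ c) (hc : Q c) :
    ∃ σ, Relation.ReflTransGen (fun α β => TraceStep α β ∧ (s → z ∈ FV β)) ρ σ ∧ Q σ := by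
  induction m generalizing ρ c with
  | zero => cases h; exact ⟨ρ, .refl, hc⟩
  | succ m ih =>
    have go : ∀ {ρ' c'}, TraceStep ρ ρ' → GuardedPath s {z} m ρ' c' → Q c' →
        ∃ σ, Relation.ReflTransGen (fun α β => TraceStep α β ∧ (s → z ∈ FV β)) ρ σ ∧ Q σ := by
      intro ρ' c' hst h hc
      obtain ⟨σ, h1, h2⟩ := ih (hst.isTidy ht) h hc
      refine ⟨σ, .head ⟨hst, fun hs => ?_⟩ h1, h2⟩
      obtain ⟨v, hv, rfl⟩ := h.guard hs
      exact hv
    cases h with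
    | step hg hch hp =>
      cases hch with
      | and_left | and_right | or_left | or_right | dia | box =>
        rw [Set.union_empty] at hp
        exact go (by constructor) hp hc
      | fix η y a =>
        have hyz : s → y ≠ z := by
          rintro hs rfl
          obtain ⟨v, hv, rfl⟩ := hg hs
          exact hv.2 rfl
        rcases hp.subst (X' := {z}) ht.freeFor
          (fun _ v hv => hv.1.resolve_right hv.2) (fun hs _ => hg hs) with ⟨h1, h2⟩ | h1
        · exact go (.fix η y _) h1 (hQ _ _ _ hyz h2 hc)
        · exact go (.fix η y _) h1 hc

theorem reach_var {z : V} {φ : MuForm V} (ht : IsTidy φ) (hp : PosIn z φ) (hz : z ∈ FV φ) :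
    Reach φ (var z) := by
  obtain ⟨m, hm⟩ := exists_guardedPath_var hp hz
  obtain ⟨σ, h, rfl⟩ := hm.exists_trace (Q := (· = var z))
    (by rintro χ y c hy - rfl; simp [subst, (hy trivial).symm]) ht rfl
  exact reach_of_reflTransGen h

theorem TraceStep.posIn {α β : MuForm V} {z : V} (h : TraceStep α β) (hp : PosIn z α) :
    PosIn z β := by
  cases h with
  | fix η y a => exact PosIn.subst (show PosIn z a from hp) hp
  | and_left | or_left => exact hp.1
  | and_right | or_right => exact hp.2
  | dia | box => exact hp

theorem TraceStep.subst {ψ α β : MuForm V} {z : V} (h : TraceStep α β)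
    (hψ : Disjoint (FV ψ) (BV α)) (hz : z ∉ BV α) :
    TraceStep (subst ψ z α) (MuForm.subst ψ z β) := by
  cases h with
  | fix η y a =>
    simp only [BV, Set.mem_insert_iff, not_or, Set.disjoint_insert_right] at hz hψ
    have hyz : ¬ y = z := fun e => hz.1 e.symm
    rw [subst_subst hyz hψ.1 hz.2]
    simp only [MuForm.subst, hyz, if_false]
    constructor
  | _ => constructor

theorem Reach.subst {ψ α β : MuForm V} {z : V} (h : Reach α β) (ht : IsTidy α)
    (hψ : Disjoint (FV ψ) (BV α)) (hz : z ∉ BV α) :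
    Reach (subst ψ z α) (MuForm.subst ψ z β) := by
  induction h with
  | refl => exact .refl
  | tail hr h ih =>
    have hB := (Reach.FV_BV_subset hr ht).2
    exact .tail ih (h.subst (hψ.mono_right hB) fun h => hz (hB h))

/-- Below a fixpoint formula on top of a nested chain lies a member of its cluster on top of the
rest of the chain. -/
theorem GuardedPath.exists_closLE [Infinite V] {η η' : FixOp} {x : V} {b c : MuForm V} {m k : ℕ}
    (ht : IsTidy (fix η x b)) (h : GuardedPath True {x} m b c) (hc : NestChain η' k c) :
    ∃ φ ∈ cluster (fix η x b), ClosLE φ (fix η x b) ∧ NestChain η' k φ := by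
  set ψ := fix η x b with hψ
  obtain ⟨z, hz, hz'⟩ := exists_fresh ψ
  have hz'b : z ∉ BV b := fun h => hz' (Or.inr h)
  have hzx : z ≠ x := fun e => hz' (Or.inl e)
  have hzb : z ∉ FV b := fun h => hz ⟨h, hzx⟩
  have hf : FreeFor (var z) x b :=
    ⟨ht.wf.1, noCapture_of_disjoint (Set.disjoint_singleton_left.2 hz'b)⟩
  set ρ := MuForm.subst (var z) x b with hρ
  have hρF : ∀ v, v ∈ FV ρ → v ∈ FV ψ ∨ v = z := by
    intro v hv
    rw [hρ, mem_FV_subst hf] at hv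
    rcases hv with hv | hv
    · exact Or.inl hv
    · exact Or.inr hv.2
  have hρB : BV ρ ⊆ BV b := by simpa [BV] using BV_subst_subset (var z) x b
  have hρt : IsTidy ρ := by
    refine ⟨ht.wf.2.subst trivial hf, Set.disjoint_left.2 fun v hv hv' => ?_⟩
    rcases hρF v hv with h | rfl
    · exact Set.disjoint_left.1 ht.disj h (Or.inr (hρB hv'))
    · exact hz'b (hρB hv')
  have hzρ : z ∉ BV ρ := fun h => hz'b (hρB h)
  have hdis : Disjoint (FV ψ) (BV ρ) := ht.disj.mono_right (hρB.trans (Set.subset_insert _ _))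
  have hunf : TraceStep ψ (MuForm.subst ψ z ρ) := by
    rw [hρ, subst_subst_var hzb hz'b]
    exact .fix η x b
  have hzF : z ∈ FV ρ := by
    obtain ⟨v, hv, rfl⟩ := h.guard trivial
    exact (mem_FV_subst hf z).2 (Or.inr ⟨hv, rfl⟩)
  have hpos : PosIn z ρ := (posIn_of_fresh hzb hz'b).subst trivial
  obtain ⟨c', hm, hc'⟩ : ∃ c', GuardedPath True {z} m ρ c' ∧ NestChain η' k c' := by
    rcases h.subst (X' := {z}) hf (fun _ v hv => absurd hv.1 hv.2)
      (fun _ _ => ⟨z, rfl, rfl⟩) with ⟨h1, h2⟩ | h1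
    · exact ⟨_, h1, hc.subst h2⟩
    · exact ⟨_, h1, hc⟩
  obtain ⟨σ, hσ, hσc⟩ := hm.exists_trace (Q := NestChain η' k)
    (fun _ _ _ _ hf hc => hc.subst hf) hρt hc'
  have hprops : ∀ {α}, Relation.ReflTransGen
      (fun α β => TraceStep α β ∧ (True → z ∈ FV β)) ρ α →
      IsTidy α ∧ BV α ⊆ BV ρ ∧ z ∈ FV α ∧ PosIn z α ∧
      Relation.ReflTransGen (fun α β => TraceStep α β ∧ FreeSub ψ β) (MuForm.subst ψ z ρ)
        (MuForm.subst ψ z α) := by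
    intro α h
    induction h with
    | refl => exact ⟨hρt, subset_rfl, hzF, hpos, .refl⟩
    | tail _ h ih =>
      obtain ⟨h1, h2, h3, h4, h5⟩ := ih
      have hB := h.1.BV_subset.trans h2
      have hp := h.1.posIn h4
      have ht' := h.1.isTidy h1
      exact ⟨ht', hB, h.2 trivial, hp, .tail h5
        ⟨h.1.subst (hdis.mono_right h2) fun h => hzρ (h2 h), _, z, ht'.wf, h.2 trivial,
          ⟨hp, noCapture_of_disjoint (hdis.mono_right hB)⟩, rfl⟩⟩
  obtain ⟨hσt, hσB, hσz, hσp, hσr⟩ := hprops hσ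
  have hσd := hdis.mono_right hσB
  have hσf : FreeFor ψ z σ := ⟨hσp, noCapture_of_disjoint hσd⟩
  have hσr' : Relation.ReflTransGen (fun α β => TraceStep α β ∧ FreeSub ψ β) ψ
      (MuForm.subst ψ z σ) :=
    .head ⟨hunf, ρ, z, hρt.wf, hzF, ⟨hpos, noCapture_of_disjoint hdis⟩, rfl⟩ hσr
  have hchain := hσc.subst hσf
  refine ⟨MuForm.subst ψ z σ, ⟨reach_of_reflTransGen hσr', ?_⟩,
    ⟨⟨_, hchain.isFixOf⟩, ⟨η, x, b, rfl⟩, ?_, hσr'⟩, hchain⟩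
  · have := (reach_var hσt hσp hσz).subst (ψ := ψ) hσt hσd fun h => hzρ (hσB h)
    simpa [MuForm.subst] using this
  · exact ⟨var z, z, trivial, rfl, ⟨trivial, trivial⟩, by simp [MuForm.subst]⟩

theorem NestChain.exists_isAltChain [Infinite V] {η : FixOp} {k : ℕ} {ψ : MuForm V}
    (h : NestChain η k ψ) (ht : IsTidy ψ) :
    ∃ c, IsAltChain (c ++ [ψ]) ∧ (∀ φ ∈ c ++ [ψ], φ ∈ cluster ψ) ∧ c.length + 1 = k := by
  induction k generalizing η ψ with
  | zero => cases h
  | succ k ih =>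
    cases h with
    | single _ x a =>
      refine ⟨[], ⟨?_, by simp⟩, ?_, rfl⟩
      · simpa using ⟨ht, η, x, a, rfl⟩
      · simpa using ⟨.refl, .refl⟩
    | @cons _ x a c m _ hp hc =>
      obtain ⟨φ, hφ, hle, hφc⟩ := hp.exists_closLE ht hc
      obtain ⟨l, hl, hlC, rfl⟩ := ih hφc (hφ.1.isTidy ht)
      refine ⟨l ++ [φ], ⟨?_, ?_⟩, ?_, by simp⟩
      · intro θ hθ
        rcases List.mem_append.1 hθ with h | h
        · exact hl.1 θ h
        · rw [List.mem_singleton.1 h]; exact ⟨ht, η, x, a, rfl⟩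
      · rw [List.isChain_append]
        refine ⟨hl.2, by simp, ?_⟩
        simp only [List.getLast?_append, List.getLast?_singleton, Option.some_or, List.head?_cons,
          Option.mem_def, Option.some.injEq]
        rintro _ rfl _ rfl
        refine ⟨⟨hle, fun hge => ?_⟩, η.dual, hφc.isFixOf, by
          rw [FixOp.dual_dual]; exact ⟨x, a, rfl⟩⟩
        obtain ⟨_, _, e⟩ := hφc.isFixOf
        rw [hle.antisymm hge] at e
        simp only [fix.injEq] at e
        exact η.dual_ne e.1.symm
      · intro θ hθ
        rcases List.mem_append.1 hθ with h | h
        · have := hlC θ h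
          exact ⟨hφ.1.trans this.1, this.2.trans hφ.2⟩
        · rw [List.mem_singleton.1 h]; exact ⟨.refl, .refl⟩

/-- Nested chains below a subformula reappear below a member of the closure. -/
theorem Subformula.exists_mem_clos {η : FixOp} {k : ℕ} {ξ c : MuForm V} (ht : IsTidy ξ)
    (h : Subformula c ξ) (hc : NestChain η k c) : ∃ ψ ∈ Clos ξ, NestChain η k ψ := by
  obtain ⟨m, hm⟩ := h
  obtain ⟨z, -⟩ : ∃ z : V, True := by
    obtain ⟨x, -⟩ := hc.isFixOf
    exact ⟨x, trivial⟩
  obtain ⟨σ, h1, h2⟩ := (hm.mono (X' := {z}) False.elim).exists_trace (Q := NestChain η k)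
    (fun _ _ _ _ hf hc => hc.subst hf) ht hc
  exact ⟨σ, reach_of_reflTransGen h1, h2⟩

end MuForm

namespace MuForm

variable {V : Type*} [DecidableEq V]

/-! ### Closure depth and alternation depth -/

theorem NestBound.length_le [Infinite V] {η : FixOp} {n : ℕ} {ξ : MuForm V} {c : List (MuForm V)}
    (hb : NestBound η n ξ) (ht : IsTidy ξ) (hc : IsAltChain c) (hC : ∀ φ ∈ c, φ ∈ Clos ξ)
    (hl : LeadsUpTo η c) : c.length ≤ n := by
  obtain ⟨φ, hφ, hη⟩ := hl
  obtain ⟨l, rfl⟩ := List.getLast?_eq_some_iff.1 hφ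
  have := hb.of_reach ht (hC φ (by simp)) _ _ (.refl φ) (hc.nestChain hη)
  simpa using this

theorem IsAltChain.eq_nil_or_leadsUpTo {c : List (MuForm V)} (hc : IsAltChain c) :
    c = [] ∨ ∃ η, LeadsUpTo η c := by
  induction c using List.reverseRecOn with
  | nil => exact Or.inl rfl
  | append_singleton l φ _ =>
    obtain ⟨η, h⟩ := (hc.1 φ (by simp)).2
    exact Or.inr ⟨η, φ, by simp, h⟩

theorem cdEta_le_iff_nestBound [Infinite V] {η : FixOp} {n : ℕ} {ξ : MuForm V} (ht : IsTidy ξ) :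
    cdEta η ξ ≤ n ↔ NestBound η n ξ := by
  constructor
  · intro h c k hc hk
    obtain ⟨ψ, hψ, hk⟩ := hc.exists_mem_clos ht hk
    obtain ⟨l, h1, h2, rfl⟩ := hk.exists_isAltChain (Reach.isTidy hψ ht)
    simp only [cdEta, cdEtaCluster, iSup_le_iff] at h
    have := h ψ hψ (l ++ [ψ]) ⟨h1, h2, ψ, by simp, hk.isFixOf⟩
    simpa using (Nat.cast_le (α := ℕ∞)).1 this
  · intro hb
    simp only [cdEta, cdEtaCluster, iSup_le_iff]
    rintro φ hφ c ⟨h1, h2, h3⟩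
    exact Nat.cast_le.2
      (hb.length_le ht h1 (fun θ hθ => Relation.ReflTransGen.trans hφ (h2 θ hθ).1) h3)

theorem cdEta_le_iff_ah [Infinite V] {η : FixOp} {n : ℕ} {ξ : MuForm V} (ht : IsTidy ξ) :
    cdEta η ξ ≤ n ↔ AH η n ξ :=
  (cdEta_le_iff_nestBound ht).trans ⟨ah_of_nestBound ht.wf, AH.nestBound⟩

theorem cd_le_iff {n : ℕ∞} {ξ : MuForm V} : cd ξ ≤ n ↔ ∀ η, cdEta η ξ ≤ n := by
  simp only [cd, cdEta, cdCluster, cdEtaCluster, iSup_le_iff]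
  constructor
  · exact fun h η φ hφ c hc => h φ hφ c ⟨hc.1, hc.2.1⟩
  · rintro h φ hφ c ⟨h1, h2⟩
    rcases h1.eq_nil_or_leadsUpTo with rfl | ⟨η, h3⟩
    · simp
    · exact h η φ hφ c ⟨h1, h2, h3⟩

theorem cd_le_iff_ah [Infinite V] {n : ℕ} {ξ : MuForm V} (ht : IsTidy ξ) :
    cd ξ ≤ n ↔ AH .mu n ξ ∧ AH .nu n ξ := by
  rw [cd_le_iff, ← cdEta_le_iff_ah ht, ← cdEta_le_iff_ah ht]
  exact ⟨fun h => ⟨h _, h _⟩, fun h η => by cases η; exacts [h.1, h.2]⟩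

theorem isLeast_ad [Infinite V] {ξ : MuForm V} (ht : IsTidy ξ) :
    IsLeast {n : ℕ | AH .mu n ξ ∧ AH .nu n ξ} ξ.ad :=
  ⟨Nat.sInf_mem (s := {n : ℕ | AH .mu n ξ ∧ AH .nu n ξ})
    ⟨size ξ, ah_of_nestBound ht.wf (nestBound_size _ ξ),
      ah_of_nestBound ht.wf (nestBound_size _ ξ)⟩,
    fun _ hn => Nat.sInf_le hn⟩

theorem ad_eq_cd [Infinite V] {ξ : MuForm V} (ht : IsTidy ξ) : (ξ.ad : ℕ∞) = ξ.cd := by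
  have hle : cd ξ ≤ ξ.ad := (cd_le_iff_ah ht).2 (isLeast_ad ht).1
  obtain ⟨m, hm⟩ := ENat.ne_top_iff_exists.1 (ne_top_of_le_ne_top (ENat.natCast_ne_top _) hle)
  refine le_antisymm ?_ hle
  rw [← hm]
  exact Nat.cast_le.2 ((isLeast_ad ht).2 ((cd_le_iff_ah ht).1 hm.ge))

theorem isGreatest_ad [Infinite V] {ξ : MuForm V} (ht : IsTidy ξ) :
    IsGreatest {k : ℕ | ∃ c : List (MuForm V),
      IsAltChain c ∧ (∀ φ ∈ c, φ ∈ ξ.Clos) ∧ c.length = k} ξ.ad := by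
  have upper : ∀ c : List (MuForm V), IsAltChain c → (∀ φ ∈ c, φ ∈ ξ.Clos) →
      c.length ≤ ξ.ad := by
    intro c h1 h2
    rcases h1.eq_nil_or_leadsUpTo with rfl | ⟨η, h3⟩
    · simp
    · have had := (isLeast_ad ht).1
      have hη : AH η ξ.ad ξ := by cases η; exacts [had.1, had.2]
      exact hη.nestBound.length_le ht h1 h2 h3
  refine ⟨?_, fun k ⟨c, h1, h2, h3⟩ => h3 ▸ upper c h1 h2⟩
  by_contra hn
  have hlt : ∀ c : List (MuForm V), IsAltChain c → (∀ φ ∈ c, φ ∈ ξ.Clos) →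
      c.length < ξ.ad := fun c h1 h2 =>
    lt_of_le_of_ne (upper c h1 h2) fun e => hn ⟨c, h1, h2, e⟩
  have hpos := hlt [] ⟨by simp, by simp⟩ (by simp)
  have hcd : cd ξ ≤ ((ξ.ad - 1 : ℕ) : ℕ∞) := by
    simp only [cd, cdCluster, iSup_le_iff]
    rintro φ hφ c ⟨h1, h2⟩
    have := hlt c h1 fun θ hθ => Relation.ReflTransGen.trans hφ (h2 θ hθ).1
    exact Nat.cast_le.2 (by omega)
  rw [← ad_eq_cd ht, Nat.cast_le] at hcd
  simp only [List.length_nil] at hpos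
  omega

end MuForm

theorem propositionp {V : Type*} [DecidableEq V] [Infinite V]
    (ξ : MuForm V) (hξ : ξ.IsTidy) :
    (∀ (η : FixOp) (n : ℕ), MuForm.cdEta η ξ ≤ (n : ℕ∞) ↔ MuForm.AH η n ξ) ∧
    IsLeast {n : ℕ | MuForm.AH .mu n ξ ∧ MuForm.AH .nu n ξ} ξ.ad ∧
    (ξ.ad : ℕ∞) = ξ.cd ∧
    IsGreatest {k : ℕ | ∃ c : List (MuForm V),
      MuForm.IsAltChain c ∧ (∀ φ ∈ c, φ ∈ ξ.Clos) ∧ c.length = k} ξ.ad :=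
  ⟨fun _ _ => MuForm.cdEta_le_iff_ah hξ, MuForm.isLeast_ad hξ, MuForm.ad_eq_cd hξ,
    MuForm.isGreatest_ad hξ⟩
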